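/- Work in Gödel–Bernays class theory GBC, where only the axiom of choice for sets (each set of nonempty sets has a choice function) is required, not global choice. That is, let $(V,\in,\mathcal C)$ be an arbitrary model of this theory, with sets the elements of $V$ and classes the members of $\mathcal C$; "set", "function", "ordinal", "cardinal", "measurable", $V_\kappa$ are understood inside the model. An *inner model* is a transitive class $W$ that contains all ordinals and satisfies ZFC. For a collection $P$ of sets, *inner-model reflection for assertions with parameters in $P$* is the following schema: for every formula $\varphi(x_1,\dots,x_n)$ of the first-order language $\{\in\}$ of set theory and all $a_1,\dots,a_n\in P$, if $\varphi(a_1,\dots,a_n)$ is true in $V$, then there is an inner model $W\subsetneq V$ with $a_1,\dots,a_n\in W$ such that $W\models\varphi(a_1,\dots,a_n)$. The *lightface inner-model reflection principle* is the schema for sentences: every sentence true in $V$ is true in some inner model $W\subsetneq V$. The *full inner-model reflection principle* allows arbitrary sets as parameters. A cardinal $\kappa$ is *measurable* if it is uncountable and carries a $\kappa$-complete nonprincipal ultrafilter. **Theorem.** 1. If there is a measurable cardinal, then the lightface inner-model reflection principle holds. 2. Indeed, if $\kappa$ is a measurable cardinal, then inner-model reflection holds for assertions with parameters in $V_\kappa$.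 3. If there is a proper class of measurable cardinals (i.e. the measurable cardinals do not form a set), then the full inner-model reflection principle holds. -/

import Mathlib

universe u

namespace InnerModelReflect

/-! ## The first-order language of set theory -/

/-- The only relation symbol of the language of set theory: a binary symbol for membership. -/
inductive MemRel : ℕ → Type
  | mem : MemRel 2

/-- The first-order language of set theory. -/
def setLang : FirstOrder.Language.{0, 0} := ⟨fun _ => Empty, MemRel⟩

/-- The structure for the language of set theory given by a relation `E`, where `E x y` is read
as "x is an element of y". -/
@[reducible] def memStructure {M : Type u} (E : M → M → Prop) : setLang.Structure M where
  funMap := fun f _ => Empty.elim f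
  RelMap := fun r v => match r, v with
    | MemRel.mem, v => E (v 0) (v 1)

/-- `Sat E φ v`: the formula `φ` is true in `(M, E)` under the assignment `v`. -/
def Sat {M : Type u} (E : M → M → Prop) {α : Type} (φ : setLang.Formula α) (v : α → M) : Prop :=
  @FirstOrder.Language.Formula.Realize setLang M (memStructure E) α φ v

/-- Relation symbols of the language of set theory expanded by one unary predicate for each
class in the collection `𝒞`. -/
inductive ClassRel {V : Type u} (𝒞 : Set (Set V)) : ℕ → Type u
  | mem : ClassRel 𝒞 2
  | cls (X : 𝒞) : ClassRel 𝒞 1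

/-- The language of set theory expanded by a predicate for each class in `𝒞`. Its quantifiers
range over sets only. -/
def classLang {V : Type u} (𝒞 : Set (Set V)) : FirstOrder.Language.{0, u} := ⟨fun _ => Empty, ClassRel 𝒞⟩

/-- The structure `(V, E)` together with all the classes in `𝒞` as predicates. -/
@[reducible] def classStructure {V : Type u} (E : V → V → Prop) (𝒞 : Set (Set V)) :
    (classLang 𝒞).Structure V where
  funMap := fun f _ => Empty.elim f
  RelMap := fun r v => match r, v with
    | ClassRel.mem, v => E (v 0) (v 1)
    | ClassRel.cls X, v => v 0 ∈ X.1

/-- Truth in `(V, E)` of a formula that may mention classes from `𝒞` as predicates. -/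
def ClassSat {V : Type u} (E : V → V → Prop) (𝒞 : Set (Set V)) {α : Type}
    (φ : (classLang 𝒞).Formula α) (v : α → V) : Prop :=
  @FirstOrder.Language.Formula.Realize (classLang 𝒞) V (classStructure E 𝒞) α φ v

/-! ## Basic set-theoretic notions inside a structure `(M, E)` -/

section Internal

variable {M : Type u} (E : M → M → Prop)

/-- `x ⊆ y`. -/
def IsSub (x y : M) : Prop := ∀ z, E z x → E z y

/-- `p = {x, y}`. -/
def IsUPair (p x y : M) : Prop := ∀ z, E z p ↔ z = x ∨ z = y

/-- `p` is the Kuratowski pair `{{x}, {x, y}}`. -/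
def IsPair (p x y : M) : Prop := ∀ z, E z p ↔ IsUPair E z x x ∨ IsUPair E z x y

/-- `s = x ∪ {x}`. -/
def IsSucc (s x : M) : Prop := ∀ z, E z s ↔ E z x ∨ z = x

/-- The ordered pair of `x` and `y` is an element of the set `f`. -/
def PairIn (f x y : M) : Prop := ∃ p, IsPair E p x y ∧ E p f

/-- The set `f` is a function with domain `d`. -/
def IsFunOn (f d : M) : Prop :=
  (∀ p, E p f → ∃ x y, E x d ∧ IsPair E p x y) ∧ ∀ x, E x d → ∃! y, PairIn E f x y

/-- `x` is a transitive set. -/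
def IsTransSet (x : M) : Prop := ∀ y, E y x → IsSub E y x

/-- `α` is an ordinal: a transitive set of transitive sets (the standard notion, under
foundation). -/
def IsOrd (α : M) : Prop := IsTransSet E α ∧ ∀ x, E x α → IsTransSet E x

/-- `κ` is a cardinal: an ordinal onto which no smaller ordinal can be mapped. -/
def IsCard (κ : M) : Prop :=
  IsOrd E κ ∧ ∀ α, E α κ → ¬ ∃ f, IsFunOn E f α ∧ ∀ y, E y κ ↔ ∃ x, PairIn E f x y

/-- `κ` is an uncountable cardinal: a cardinal having a nonzero limit ordinal as an element,
that is, `ω < κ`. -/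
def IsUncountableCard (κ : M) : Prop :=
  IsCard E κ ∧ ∃ w, E w κ ∧ (∃ x, E x w) ∧ ∀ x, E x w → ∃ s, IsSucc E s x ∧ E s w

/-- `U` is an ultrafilter on the set `κ`. -/
structure IsUltrafilterOn (U κ : M) : Prop where
  sub : ∀ X, E X U → IsSub E X κ
  top : E κ U
  up : ∀ X Y, E X U → IsSub E X Y → IsSub E Y κ → E Y U
  inter : ∀ X Y Z, E X U → E Y U → (∀ z, E z Z ↔ E z X ∧ E z Y) → E Z U
  /-- of a subset of `κ` and its complement exactly one belongs to `U` -/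
  ultra : ∀ X Y, IsSub E X κ → (∀ z, E z Y ↔ E z κ ∧ ¬ E z X) → (E X U ↔ ¬ E Y U)

/-- `U` contains no singleton. -/
def IsNonprincipal (U : M) : Prop := ∀ X x, IsUPair E X x x → ¬ E X U

/-- `U` is closed under intersections of length less than `κ`: for each sequence `s` of elements
of `U` indexed by some `δ < κ`, the set of those elements of `κ` that lie in all members of the
sequence is in `U`. -/
def IsCompleteFor (U κ : M) : Prop :=
  ∀ δ, E δ κ → ∀ s, IsFunOn E s δ → (∀ β X, PairIn E s β X → E X U) →
    ∀ Y, (∀ z, E z Y ↔ E z κ ∧ ∀ β X, PairIn E s β X → E z X) → E Y U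

/-- `κ` is a measurable cardinal: an uncountable cardinal that carries a `κ`-complete
nonprincipal ultrafilter. -/
def IsMeasurableCard (κ : M) : Prop :=
  IsUncountableCard E κ ∧
    ∃ U, IsUltrafilterOn E U κ ∧ IsNonprincipal E U ∧ IsCompleteFor E U κ

/-- `v = V_κ`, where `κ` is an ordinal: there is a function `h` with domain `κ + 1` such that
`h β` is the union of the power sets of `h γ` for `γ < β`, and `h κ = v`. -/
def IsVLevel (κ v : M) : Prop :=
  ∃ h s, IsSucc E s κ ∧ IsFunOn E h s ∧
    (∀ β y, PairIn E h β y →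
      ∀ x, E x y ↔ ∃ γ z, E γ β ∧ PairIn E h γ z ∧ IsSub E x z) ∧
    PairIn E h κ v

/-- `a ∈ V_κ`. -/
def MemVLevel (κ a : M) : Prop := ∃ v, IsVLevel E κ v ∧ E a v

/-! ## The axioms -/

/-- The axioms that ZFC and GBC have in common. -/
structure BasicAxioms : Prop where
  ext : ∀ x y, (∀ z, E z x ↔ E z y) → x = y
  pairing : ∀ x y, ∃ p, IsUPair E p x y
  union : ∀ x, ∃ y, ∀ z, E z y ↔ ∃ w, E w x ∧ E z w
  powerset : ∀ x, ∃ y, ∀ z, E z y ↔ IsSub E z x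
  infinity : ∃ w, (∃ e, (∀ z, ¬ E z e) ∧ E e w) ∧ ∀ x, E x w → ∃ s, IsSucc E s x ∧ E s w
  foundation : ∀ x, (∃ y, E y x) → ∃ y, E y x ∧ ∀ z, E z y → ¬ E z x
  /-- each set of nonempty sets has a choice function -/
  choice : ∀ a, (∀ x, E x a → ∃ y, E y x) →
    ∃ f, IsFunOn E f a ∧ ∀ x y, PairIn E f x y → E y x

/-- `(M, E)` is a model of ZFC. -/
structure ModelsZFC : Prop extends BasicAxioms E where
  /-- the separation schema, for formulas with parameters -/
  separation : ∀ (n : ℕ) (φ : setLang.Formula (Fin (n + 1))) (p : Fin n → M) (a : M),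
    ∃ b, ∀ x, E x b ↔ E x a ∧ Sat E φ (Fin.cons x p)
  /-- the replacement schema, for formulas with parameters -/
  replacement : ∀ (n : ℕ) (φ : setLang.Formula (Fin (n + 2))) (p : Fin n → M) (a : M),
    (∀ x, E x a → ∃! y, Sat E φ (Fin.cons x (Fin.cons y p))) →
    ∃ b, ∀ y, E y b ↔ ∃ x, E x a ∧ Sat E φ (Fin.cons x (Fin.cons y p))

end Internal

/-- `(V, E, 𝒞)`, with sets the elements of `V` and classes the members of `𝒞`, is a model of
Gödel-Bernays set theory with the axiom of choice for sets. (Global choice is not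
required.) -/
structure ModelsGBC {V : Type u} (E : V → V → Prop) (𝒞 : Set (Set V)) : Prop
    extends BasicAxioms E where
  /-- class comprehension: formulas with set and class parameters that quantify over sets only
  define classes -/
  comprehension : ∀ (n : ℕ) (φ : (classLang 𝒞).Formula (Fin (n + 1))) (p : Fin n → V),
    {x | ClassSat E 𝒞 φ (Fin.cons x p)} ∈ 𝒞
  /-- every nonempty class has an `E`-minimal element -/
  class_foundation : ∀ X ∈ 𝒞, X.Nonempty → ∃ x ∈ X, ∀ y, E y x → y ∉ X
  /-- the image of a set under a class function is a set -/
  class_replacement : ∀ F ∈ 𝒞,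
    (∀ x y z p q, IsPair E p x y → p ∈ F → IsPair E q x z → q ∈ F → y = z) →
    ∀ a, ∃ b, ∀ y, E y b ↔ ∃ x, E x a ∧ ∃ p ∈ F, IsPair E p x y

/-! ## Inner models and inner-model reflection -/

section Reflection

variable {V : Type u} (E : V → V → Prop) (𝒞 : Set (Set V))

/-- The membership relation of `V` restricted to the class `W`. -/
def restrictMem (W : Set V) : W → W → Prop := fun x y => E x y

/-- `W` is an inner model: a transitive class that contains all ordinals and is a model of
ZFC. -/
structure IsInnerModel (W : Set V) : Prop where
  isClass : W ∈ 𝒞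
  transitive : ∀ x ∈ W, ∀ y, E y x → y ∈ W
  ordinals : ∀ α, IsOrd E α → α ∈ W
  models : ModelsZFC (restrictMem E W)

/-- Inner-model reflection for assertions with parameters from `P`: each statement `φ(a₁, …, aₙ)`
of the first-order language of set theory, with parameters in `P`, that is true in `V` is true in
some inner model `W ≠ V` containing the parameters. -/
def InnerModelReflectionFor (P : Set V) : Prop :=
  ∀ (n : ℕ) (φ : setLang.Formula (Fin n)) (a : Fin n → V), (∀ i, a i ∈ P) → Sat E φ a →
    ∃ W : Set V, IsInnerModel E 𝒞 W ∧ W ≠ Set.univ ∧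
      ∃ ha : ∀ i, a i ∈ W, Sat (restrictMem E W) φ (fun i => (⟨a i, ha i⟩ : W))

/-- The full inner-model reflection principle: arbitrary sets are allowed as parameters. -/
def InnerModelReflection : Prop := InnerModelReflectionFor E 𝒞 Set.univ

/-- The lightface inner-model reflection principle: each sentence true in `V` is true in some
inner model `W ≠ V`. -/
def LightfaceInnerModelReflection : Prop :=
  ∀ σ : setLang.Sentence, Sat E σ Empty.elim →
    ∃ W : Set V, IsInnerModel E 𝒞 W ∧ W ≠ Set.univ ∧ Sat (restrictMem E W) σ Empty.elim

end Reflection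

end InnerModelReflect

open InnerModelReflect

universe w

namespace InnerModelReflect

open FirstOrder FirstOrder.Language

set_option synthInstance.maxSize 2000
set_option synthInstance.maxHeartbeats 200000

/-! ## Uniform definability in families of structures -/

section SatLemmas

variable {M : Type u} (E : M → M → Prop) {α β : Type}

/-! Let `U` be a measure on `κ`, form the ultrapower of `V` by `U`, and let `W` be its transitive
collapse, with embedding `j : V → W` sending `a` to the class of its constant function. By Łoś's
theorem (`IsMeasure.realize_ultrapower`) `j` is elementary and `W` satisfies ZFC. `W` is definable
from `κ` and `U`, hence a class, and it contains every ordinal because `α ≤ j(α)`. Completeness of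
`U` makes `j` the identity on `V_κ` (`IsMeasure.ultraEmbedding_eq_self`), so a statement about
parameters in `V_κ` holds in `W` whenever it holds in `V`. This gives part 2. Part 1 is the case
without parameters. For part 3, finitely many parameters lie in some `V_θ`, and there is a
measurable cardinal above `θ`.

That `W ≠ V` (`IsMeasure.ultrapower_ne_univ`) follows from a least counterexample: the least `κ`
carrying a measure whose collapsed ultrapower is all of `V` is definable without parameters, so an
elementary `j : V → V` would fix it, whereas `κ ∈ j(κ)`.

Global choice is avoided, and so are proper classes of representatives. Every set `f` represents an
element of the ultrapower through the total operation `app`, and the collapse is computed on the set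
of relations between `κ` and a transitive set `x`. This set is closed downwards modulo `U`, so the
local collapses cohere (`IsMeasure.collapse_agree`). Only set choice is used, in `exists_choice`.

All uses of the schemas need explicit formulas. `IsDef` provides them by instance search. Its index
type allows one formula to define a notion in many structures at once: with `Unit` and all
parameters it gives the definable classes of `V`; with all structures and no parameters it gives the
statements that Łoś's theorem transfers. -/

theorem sat_relabel (φ : setLang.Formula α) (g : α → β) (v : β → M) :
    Sat E (φ.relabel g) v ↔ Sat E φ (v ∘ g) := by
  let := memStructure E
  exact Formula.realize_relabel

theorem sat_imp (φ ψ : setLang.Formula α) (v : α → M) :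
    Sat E (φ.imp ψ) v ↔ (Sat E φ v → Sat E ψ v) := Iff.rfl

theorem sat_bot (v : α → M) : ¬ Sat E (⊥ : setLang.Formula α) v := fun h => h

/-- Universal quantification over the first free variable of a formula. -/
def allFirst {n : ℕ} (φ : setLang.Formula (Fin (n + 1) ⊕ β)) : setLang.Formula (Fin n ⊕ β) :=
  BoundedFormula.all (n := 0) (BoundedFormula.relabel (n := 1) (k := 0)
    (Sum.elim (Fin.cases (Sum.inr 0) (fun k => Sum.inl (Sum.inl k))) (fun b => Sum.inl (Sum.inr b))) φ)

theorem sat_allFirst {n : ℕ} (φ : setLang.Formula (Fin (n + 1) ⊕ β)) (v : Fin n → M) (c : β → M) :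
    Sat E (allFirst φ) (Sum.elim v c) ↔ ∀ y, Sat E φ (Sum.elim (Fin.cons y v) c) := by
  let := memStructure E
  unfold Sat allFirst Formula.Realize
  rw [BoundedFormula.realize_all]
  refine forall_congr' fun y => ?_
  rw [BoundedFormula.realize_relabel]
  refine iff_of_eq (congr_arg₂ _ ?_ (Subsingleton.elim _ _))
  funext k
  rcases k with k | k
  · refine Fin.cases ?_ (fun k => ?_) k
    · simp [Fin.snoc]
    · simp
  · simp

/-- The formula `x ∈ y`. -/
def memFormula (x y : α) : setLang.Formula α :=
  Relations.formula (L := setLang) (n := 2) MemRel.mem ![Term.var x, Term.var y]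

theorem sat_mem (x y : α) (v : α → M) : Sat E (memFormula x y) v ↔ E (v x) (v y) := by
  let := memStructure E
  unfold Sat memFormula
  exact Formula.realize_rel (L := setLang) (R := (MemRel.mem : setLang.Relations 2))

theorem sat_eq (x y : α) (v : α → M) :
    Sat E (Term.equal (Term.var x) (Term.var y)) v ↔ v x = v y := by
  let := memStructure E
  unfold Sat
  rw [Formula.realize_equal]
  rfl

end SatLemmas

section Definability

variable {ι : Type w} {M : ι → Type u} {E : ∀ i, M i → M i → Prop} {A : Set (∀ i, M i)} {n m k : ℕ}

/-- A family of predicates on the structures `(M i, E i)` is definable by one formula with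
parameters from `A`. -/
class IsDef (E : ∀ i, M i → M i → Prop) (A : Set (∀ i, M i)) {n : ℕ}
    (P : ∀ i, (Fin n → M i) → Prop) : Prop where
  out : ∃ (m : ℕ) (φ : setLang.Formula (Fin n ⊕ Fin m)) (c : Fin m → ∀ i, M i),
    (∀ k, c k ∈ A) ∧ ∀ i v, P i v ↔ Sat (E i) φ (Sum.elim v (fun k => c k i))

/-- A family of functions is definable by one formula with parameters from `A`. -/
class IsDefFun (E : ∀ i, M i → M i → Prop) (A : Set (∀ i, M i)) {n : ℕ}
    (t : ∀ i, (Fin n → M i) → M i) : Prop where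
  graph : IsDef E A (n := n + 1) (fun i w => w 0 = t i (Fin.tail w))

/-- A family of maps between contexts that only selects variables. -/
class IsSel {M : ι → Type u} {n m : ℕ} (s : ∀ i, (Fin n → M i) → (Fin m → M i)) : Prop where
  out : ∃ e : Fin m → Fin n, ∀ i v, s i v = v ∘ e

instance IsSel.id : IsSel (fun i (v : Fin n → M i) => v) := ⟨⟨_root_.id, fun _ _ => rfl⟩⟩

instance IsSel.tail {s : ∀ i, (Fin n → M i) → (Fin (m + 1) → M i)} [h : IsSel s] :
    IsSel (fun i v => Fin.tail (s i v)) := by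
  obtain ⟨e, he⟩ := h.out
  exact ⟨⟨e ∘ Fin.succ, fun i v => by rw [he]; rfl⟩⟩

theorem IsDef.of_finite {P : ∀ i, (Fin n → M i) → Prop} {κ : Type} [Finite κ]
    (φ : setLang.Formula (Fin n ⊕ κ)) (c : κ → ∀ i, M i) (hc : ∀ k, c k ∈ A)
    (h : ∀ i v, P i v ↔ Sat (E i) φ (Sum.elim v (fun k => c k i))) : IsDef E A P := by
  obtain ⟨m, ⟨e⟩⟩ := Finite.exists_equiv_fin κ
  refine ⟨⟨m, φ.relabel (Sum.map _root_.id e), fun k => c (e.symm k), fun k => hc _, fun i v => ?_⟩⟩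
  rw [h, sat_relabel]
  refine iff_of_eq (congr_arg _ ?_)
  funext k
  rcases k with k | k <;> simp

theorem IsDef.congr {P Q : ∀ i, (Fin n → M i) → Prop} (h : IsDef E A P)
    (hPQ : ∀ i v, Q i v ↔ P i v) : IsDef E A Q := by
  obtain ⟨m, φ, c, hc, hP⟩ := h.out
  exact ⟨⟨m, φ, c, hc, fun i v => (hPQ i v).trans (hP i v)⟩⟩

theorem IsDef.comp_sel {P : ∀ i, (Fin m → M i) → Prop} (h : IsDef E A P)
    (s : ∀ i, (Fin n → M i) → (Fin m → M i)) [hs : IsSel s] : IsDef E A (fun i v => P i (s i v)) := by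
  obtain ⟨e, he⟩ := hs.out
  obtain ⟨m, φ, c, hc, hP⟩ := h.out
  refine ⟨⟨m, φ.relabel (Sum.map e _root_.id), c, hc, fun i v => ?_⟩⟩
  rw [hP, sat_relabel, he]
  refine iff_of_eq (congr_arg _ ?_)
  funext k
  rcases k with k | k <;> simp

instance IsDef.imp {P Q : ∀ i, (Fin n → M i) → Prop} [hP : IsDef E A P] [hQ : IsDef E A Q] :
    IsDef E A (fun i v => P i v → Q i v) := by
  obtain ⟨m, φ, c, hc, hP⟩ := hP.out
  obtain ⟨m', ψ, d, hd, hQ⟩ := hQ.out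
  refine IsDef.of_finite (κ := Fin m ⊕ Fin m')
    ((φ.relabel (Sum.map _root_.id Sum.inl)).imp (ψ.relabel (Sum.map _root_.id Sum.inr))) (Sum.elim c d)
    (by rintro (k | k) <;> simp [hc, hd]) fun i v => ?_
  rw [hP, hQ, sat_imp, sat_relabel, sat_relabel]
  refine imp_congr (iff_of_eq (congr_arg _ ?_)) (iff_of_eq (congr_arg _ ?_)) <;>
  · funext k
    rcases k with k | k <;> simp

instance IsDef.false : IsDef E A (fun i (_ : Fin n → M i) => False) :=
  ⟨⟨0, ⊥, Fin.elim0, fun k => k.elim0, fun i v => by simp [sat_bot]⟩⟩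

instance IsDef.not {P : ∀ i, (Fin n → M i) → Prop} [hP : IsDef E A P] :
    IsDef E A (fun i v => ¬ P i v) := IsDef.imp (Q := fun i _ => False)

instance IsDef.and {P Q : ∀ i, (Fin n → M i) → Prop} [hP : IsDef E A P] [hQ : IsDef E A Q] :
    IsDef E A (fun i v => P i v ∧ Q i v) :=
  IsDef.congr (P := fun i v => ¬ (P i v → ¬ Q i v)) inferInstance fun i v => by tauto

instance IsDef.or {P Q : ∀ i, (Fin n → M i) → Prop} [hP : IsDef E A P] [hQ : IsDef E A Q] :
    IsDef E A (fun i v => P i v ∨ Q i v) :=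
  IsDef.congr (P := fun i v => ¬ P i v → Q i v) inferInstance fun i v => by tauto

instance IsDef.iff {P Q : ∀ i, (Fin n → M i) → Prop} [hP : IsDef E A P] [hQ : IsDef E A Q] :
    IsDef E A (fun i v => P i v ↔ Q i v) :=
  IsDef.congr (P := fun i v => (P i v → Q i v) ∧ (Q i v → P i v)) inferInstance
    fun i v => iff_iff_implies_and_implies

/-- The bound variable becomes entry `0` of a longer context and the old context becomes its
`Fin.tail`. This shape lets instance search descend through nested quantifiers. -/
instance IsDef.all {P : ∀ i, (Fin n → M i) → M i → Prop}
    [hP : IsDef E A (n := n + 1) (fun i w => P i (Fin.tail w) (w 0))] :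
    IsDef E A (fun i v => ∀ y : M i, P i v y) := by
  obtain ⟨m, φ, c, hc, hP⟩ := hP.out
  refine ⟨⟨m, allFirst φ, c, hc, fun i v => ?_⟩⟩
  rw [sat_allFirst]
  refine forall_congr' fun y => ?_
  rw [← hP]
  simp

instance IsDef.ex {P : ∀ i, (Fin n → M i) → M i → Prop}
    [hP : IsDef E A (n := n + 1) (fun i w => P i (Fin.tail w) (w 0))] :
    IsDef E A (fun i v => ∃ y : M i, P i v y) :=
  IsDef.congr (P := fun i v => ¬ ∀ y : M i, ¬ P i v y) inferInstance fun i v => by simp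

theorem IsDefFun.comp_sel {t : ∀ i, (Fin m → M i) → M i} (h : IsDefFun E A t)
    (s : ∀ i, (Fin n → M i) → (Fin m → M i)) [hs : IsSel s] :
    IsDefFun E A (fun i v => t i (s i v)) := by
  obtain ⟨e, he⟩ := hs.out
  refine ⟨(h.graph.comp_sel (fun i w => w ∘ (Fin.cases 0 (fun k => (e k).succ) : Fin (m + 1) → _))
    (hs := ⟨⟨_, fun _ _ => rfl⟩⟩)).congr fun i v => ?_⟩
  rw [he]
  rfl

instance IsDefFun.sel {t : ∀ i, (Fin m → M i) → M i} [h : IsDefFun E A t]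
    {s : ∀ i, (Fin n → M i) → (Fin m → M i)} [hs : IsSel s] :
    IsDefFun E A (fun i w => t i (s i w)) := h.comp_sel s

/-- The language has no function symbols, so a definable function is substituted through its graph:
`Q(t(v))` holds iff some `y = t(v)` satisfies `Q(y)`. -/
theorem IsDef.comp_first {Q : ∀ i, (Fin (n + 1) → M i) → Prop} {t : ∀ i, (Fin n → M i) → M i}
    (hQ : IsDef E A Q) [ht : IsDefFun E A t] : IsDef E A (fun i v => Q i (Fin.cons (t i v) v)) := by
  have := ht.graph
  have : IsDef E A (n := n + 1) (fun i w => w 0 = t i (Fin.tail w) ∧ Q i (Fin.cons (w 0) (Fin.tail w))) := by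
    have : IsDef E A (n := n + 1) (fun i w => Q i (Fin.cons (w 0) (Fin.tail w))) :=
      hQ.congr fun i v => by rw [Fin.cons_self_tail]
    infer_instance
  exact IsDef.congr (P := fun i v => ∃ y, y = t i v ∧ Q i (Fin.cons y v)) inferInstance
    fun i v => by simp

theorem isDef_eq_var (j l : Fin n) : IsDef E A (fun i (v : Fin n → M i) => v j = v l) :=
  ⟨⟨0, Term.equal (Term.var (Sum.inl j)) (Term.var (Sum.inl l)), Fin.elim0, fun k => k.elim0, fun i v => by
    rw [sat_eq]; rfl⟩⟩

theorem isDef_mem_var (j l : Fin n) : IsDef E A (fun i (v : Fin n → M i) => E i (v j) (v l)) :=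
  ⟨⟨0, memFormula (Sum.inl j) (Sum.inl l), Fin.elim0, fun k => k.elim0, fun i v => by
    rw [sat_mem]; rfl⟩⟩

instance IsDefFun.var {s : ∀ i, (Fin n → M i) → (Fin m → M i)} [hs : IsSel s] (j : Fin m) :
    IsDefFun E A (fun i v => s i v j) := by
  obtain ⟨e, he⟩ := hs.out
  refine ⟨(isDef_eq_var 0 (e j).succ).congr fun i v => ?_⟩
  rw [he]
  rfl

theorem IsDefFun.const_of_mem {c : ∀ i, M i} (hc : c ∈ A) :
    IsDefFun E A (fun i (_ : Fin n → M i) => c i) :=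
  ⟨IsDef.of_finite (κ := Unit) (Term.equal (Term.var (Sum.inl 0)) (Term.var (Sum.inr ())))
    (fun _ => c) (fun _ => hc) fun i v => by rw [sat_eq]; rfl⟩

instance IsDefFun.const_univ {c : ∀ i, M i} :
    IsDefFun E Set.univ (fun i (_ : Fin n → M i) => c i) :=
  IsDefFun.const_of_mem trivial

theorem IsDef.comp₁ {R : ∀ i, M i → Prop} (hR : IsDef E A (fun i (v : Fin 1 → M i) => R i (v 0)))
    {a : ∀ i, (Fin n → M i) → M i} [ha : IsDefFun E A a] :
    IsDef E A (fun i v => R i (a i v)) :=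
  IsDef.comp_first (Q := fun i w => R i (w 0)) (t := a)
    (hR.comp_sel (fun i (w : Fin (n + 1) → M i) => w ∘ fun _ => 0) (hs := ⟨⟨_, fun _ _ => rfl⟩⟩))

theorem IsDef.comp₂ {R : ∀ i, M i → M i → Prop}
    (hR : IsDef E A (fun i (v : Fin 2 → M i) => R i (v 0) (v 1)))
    {a b : ∀ i, (Fin n → M i) → M i} [ha : IsDefFun E A a] [hb : IsDefFun E A b] :
    IsDef E A (fun i v => R i (a i v) (b i v)) := by
  have h1 : IsDef E A (fun i (v : Fin (n + 2) → M i) => R i (v 1) (v 0)) :=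
    hR.comp_sel (fun i w => w ∘ ![1, 0]) (hs := ⟨⟨_, fun _ _ => rfl⟩⟩)
  have h2 : IsDef E A (fun i (v : Fin (n + 1) → M i) => R i (v 0) (b i (Fin.tail v))) :=
    IsDef.comp_first (t := fun i v => b i (Fin.tail v)) h1
  exact IsDef.comp_first (t := a) h2

theorem IsDef.comp₃ {R : ∀ i, M i → M i → M i → Prop}
    (hR : IsDef E A (fun i (v : Fin 3 → M i) => R i (v 0) (v 1) (v 2)))
    {a b c : ∀ i, (Fin n → M i) → M i} [ha : IsDefFun E A a] [hb : IsDefFun E A b]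
    [hc : IsDefFun E A c] :
    IsDef E A (fun i v => R i (a i v) (b i v) (c i v)) := by
  -- Each substitution consumes variable `0`, so the arguments are listed in reverse and filled in
  -- from `c` to `a`.
  have h1 : IsDef E A (fun i (v : Fin (n + 3) → M i) => R i (v 2) (v 1) (v 0)) :=
    hR.comp_sel (fun i w => w ∘ ![2, 1, 0]) (hs := ⟨⟨_, fun _ _ => rfl⟩⟩)
  have h2 : IsDef E A (fun i (v : Fin (n + 2) → M i) => R i (v 1) (v 0) (c i (Fin.tail (Fin.tail v)))) :=
    IsDef.comp_first (t := fun i v => c i (Fin.tail (Fin.tail v))) h1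
  have h3 : IsDef E A (fun i (v : Fin (n + 1) → M i) => R i (v 0) (b i (Fin.tail v)) (c i (Fin.tail v))) :=
    IsDef.comp_first (t := fun i v => b i (Fin.tail v)) h2
  exact IsDef.comp_first (t := a) h3

instance IsDef.mem {a b : ∀ i, (Fin n → M i) → M i} [ha : IsDefFun E A a] [hb : IsDefFun E A b] :
    IsDef E A (fun i v => E i (a i v) (b i v)) := IsDef.comp₂ (isDef_mem_var 0 1)

instance IsDef.eq {a b : ∀ i, (Fin n → M i) → M i} [ha : IsDefFun E A a] [hb : IsDefFun E A b] :
    IsDef E A (fun i v => a i v = b i v) := IsDef.comp₂ (R := fun _ x y => x = y) (isDef_eq_var 0 1)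

instance IsDef.exUnique {P : ∀ i, (Fin n → M i) → M i → Prop}
    [hP : IsDef E A (n := n + 1) (fun i w => P i (Fin.tail w) (w 0))] :
    IsDef E A (fun i v => ∃! y : M i, P i v y) := by
  have : IsDef E A (n := n + 2) (fun i w => P i (Fin.tail (Fin.tail w)) (w 0)) :=
    hP.comp_sel (fun i w => w ∘ (Fin.cases 0 (fun k => k.succ.succ) : Fin (n + 1) → _))
      (hs := ⟨⟨_, fun _ _ => rfl⟩⟩)
  exact IsDef.congr (P := fun i v => ∃ y : M i, P i v y ∧ ∀ z, P i v z → z = y)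
    inferInstance fun _ _ => Iff.rfl

theorem IsDefFun.comp₁ {f : ∀ i, M i → M i}
    (hf : IsDef E A (fun i (v : Fin 2 → M i) => v 0 = f i (v 1)))
    {a : ∀ i, (Fin n → M i) → M i} [ha : IsDefFun E A a] :
    IsDefFun E A (fun i v => f i (a i v)) :=
  ⟨IsDef.comp₂ (R := fun i x y => x = f i y) hf⟩

instance IsDef.isSub {a b : ∀ i, (Fin n → M i) → M i} [ha : IsDefFun E A a] [hb : IsDefFun E A b] :
    IsDef E A (fun i v => IsSub (E i) (a i v) (b i v)) :=
  IsDef.comp₂ (by unfold IsSub; infer_instance)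

instance IsDef.isUPair {a b c : ∀ i, (Fin n → M i) → M i} [ha : IsDefFun E A a]
    [hb : IsDefFun E A b] [hc : IsDefFun E A c] :
    IsDef E A (fun i v => IsUPair (E i) (a i v) (b i v) (c i v)) :=
  IsDef.comp₃ (by unfold IsUPair; infer_instance)

instance IsDef.isPair {a b c : ∀ i, (Fin n → M i) → M i} [ha : IsDefFun E A a]
    [hb : IsDefFun E A b] [hc : IsDefFun E A c] :
    IsDef E A (fun i v => IsPair (E i) (a i v) (b i v) (c i v)) :=
  IsDef.comp₃ (by unfold IsPair; infer_instance)

instance IsDef.isSucc {a b : ∀ i, (Fin n → M i) → M i} [ha : IsDefFun E A a] [hb : IsDefFun E A b] :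
    IsDef E A (fun i v => IsSucc (E i) (a i v) (b i v)) :=
  IsDef.comp₂ (by unfold IsSucc; infer_instance)

instance IsDef.pairIn {a b c : ∀ i, (Fin n → M i) → M i} [ha : IsDefFun E A a]
    [hb : IsDefFun E A b] [hc : IsDefFun E A c] :
    IsDef E A (fun i v => PairIn (E i) (a i v) (b i v) (c i v)) :=
  IsDef.comp₃ (by unfold PairIn; infer_instance)

instance IsDef.isFunOn {a b : ∀ i, (Fin n → M i) → M i} [ha : IsDefFun E A a] [hb : IsDefFun E A b] :
    IsDef E A (fun i v => IsFunOn (E i) (a i v) (b i v)) :=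
  IsDef.comp₂ (by unfold IsFunOn; infer_instance)

instance IsDef.isTransSet {a : ∀ i, (Fin n → M i) → M i} [ha : IsDefFun E A a] :
    IsDef E A (fun i v => IsTransSet (E i) (a i v)) :=
  IsDef.comp₁ (by unfold IsTransSet; infer_instance)

instance IsDef.isOrd {a : ∀ i, (Fin n → M i) → M i} [ha : IsDefFun E A a] :
    IsDef E A (fun i v => IsOrd (E i) (a i v)) :=
  IsDef.comp₁ (by unfold IsOrd; infer_instance)

instance IsDef.isCard {a : ∀ i, (Fin n → M i) → M i} [ha : IsDefFun E A a] :
    IsDef E A (fun i v => IsCard (E i) (a i v)) :=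
  IsDef.comp₁ (by unfold IsCard; infer_instance)

instance IsDef.isUncountableCard {a : ∀ i, (Fin n → M i) → M i} [ha : IsDefFun E A a] :
    IsDef E A (fun i v => IsUncountableCard (E i) (a i v)) :=
  IsDef.comp₁ (by unfold IsUncountableCard; infer_instance)

theorem isUltrafilterOn_iff {M : Type u} {E : M → M → Prop} {U κ : M} : IsUltrafilterOn E U κ ↔
    (∀ X, E X U → IsSub E X κ) ∧ E κ U ∧
    (∀ X Y, E X U → IsSub E X Y → IsSub E Y κ → E Y U) ∧
    (∀ X Y Z, E X U → E Y U → (∀ z, E z Z ↔ E z X ∧ E z Y) → E Z U) ∧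
    (∀ X Y, IsSub E X κ → (∀ z, E z Y ↔ E z κ ∧ ¬ E z X) → (E X U ↔ ¬ E Y U)) :=
  ⟨fun h => ⟨h.1, h.2, h.3, h.4, h.5⟩, fun h => ⟨h.1, h.2.1, h.2.2.1, h.2.2.2.1, h.2.2.2.2⟩⟩

instance IsDef.isUltrafilterOn {a b : ∀ i, (Fin n → M i) → M i} [ha : IsDefFun E A a]
    [hb : IsDefFun E A b] : IsDef E A (fun i v => IsUltrafilterOn (E i) (a i v) (b i v)) :=
  IsDef.comp₂ (by simp only [isUltrafilterOn_iff]; infer_instance)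

instance IsDef.isNonprincipal {a : ∀ i, (Fin n → M i) → M i} [ha : IsDefFun E A a] :
    IsDef E A (fun i v => IsNonprincipal (E i) (a i v)) :=
  IsDef.comp₁ (by unfold IsNonprincipal; infer_instance)

instance IsDef.isCompleteFor {a b : ∀ i, (Fin n → M i) → M i} [ha : IsDefFun E A a]
    [hb : IsDefFun E A b] : IsDef E A (fun i v => IsCompleteFor (E i) (a i v) (b i v)) :=
  IsDef.comp₂ (by unfold IsCompleteFor; infer_instance)

instance IsDef.isMeasurableCard {a : ∀ i, (Fin n → M i) → M i} [ha : IsDefFun E A a] :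
    IsDef E A (fun i v => IsMeasurableCard (E i) (a i v)) :=
  IsDef.comp₁ (by unfold IsMeasurableCard; infer_instance)

theorem basicAxioms_iff {M : Type u} {E : M → M → Prop} : BasicAxioms E ↔
    (∀ x y, (∀ z, E z x ↔ E z y) → x = y) ∧ (∀ x y, ∃ p, IsUPair E p x y) ∧
    (∀ x, ∃ y, ∀ z, E z y ↔ ∃ w, E w x ∧ E z w) ∧ (∀ x, ∃ y, ∀ z, E z y ↔ IsSub E z x) ∧
    (∃ w, (∃ e, (∀ z, ¬ E z e) ∧ E e w) ∧ ∀ x, E x w → ∃ s, IsSucc E s x ∧ E s w) ∧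
    (∀ x, (∃ y, E y x) → ∃ y, E y x ∧ ∀ z, E z y → ¬ E z x) ∧
    (∀ a, (∀ x, E x a → ∃ y, E y x) →
      ∃ f, IsFunOn E f a ∧ ∀ x y, PairIn E f x y → E y x) :=
  ⟨fun h => ⟨h.1, h.2, h.3, h.4, h.5, h.6, h.7⟩,
    fun h => ⟨h.1, h.2.1, h.2.2.1, h.2.2.2.1, h.2.2.2.2.1, h.2.2.2.2.2.1, h.2.2.2.2.2.2⟩⟩

instance IsDef.basicAxioms : IsDef E A (fun i (_ : Fin n → M i) => BasicAxioms (E i)) := by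
  simp only [basicAxioms_iff]
  infer_instance

/-- Induction on the formula, with definable functions in place of its variables. The context length
`n` is generalized because each quantifier lengthens it. -/
theorem IsDef.realize {α : Type} (φ : setLang.BoundedFormula α k)
    (t : α → ∀ i, (Fin n → M i) → M i) (s : Fin k → ∀ i, (Fin n → M i) → M i)
    (ht : ∀ j, IsDefFun E A (t j)) (hs : ∀ j, IsDefFun E A (s j)) :
    IsDef E A (fun i v => @BoundedFormula.Realize setLang (M i) (memStructure (E i)) α k φ
      (fun j => t j i v) (fun j => s j i v)) := by
  have hterm : ∀ {k} (r : setLang.Term (α ⊕ Fin k)) {n} (t : α → ∀ i, (Fin n → M i) → M i)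
      (s : Fin k → ∀ i, (Fin n → M i) → M i), (∀ j, IsDefFun E A (t j)) →
      (∀ j, IsDefFun E A (s j)) → IsDefFun E A (fun i v => @Term.realize setLang (M i)
        (memStructure (E i)) _ (Sum.elim (fun j => t j i v) (fun j => s j i v)) r) := by
    intro k r n t s ht hs
    rcases r with (j | j) | f
    · exact ht j
    · exact hs j
    · exact Empty.elim f
  induction φ generalizing n with
  | falsum => exact IsDef.false
  | equal r₁ r₂ =>
    have := hterm r₁ t s ht hs
    have := hterm r₂ t s ht hs
    exact IsDef.eq
  | rel R r =>
    cases R with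
    | mem =>
      have := hterm (r 0) t s ht hs
      have := hterm (r 1) t s ht hs
      exact IsDef.mem
  | imp _ _ ih₁ ih₂ =>
    have := ih₁ t s ht hs
    have := ih₂ t s ht hs
    exact IsDef.imp
  | @all k φ ih =>
    have := ih (n := n + 1) (fun j i v => t j i (Fin.tail v))
      (Fin.snoc (α := fun _ => ∀ i, (Fin (n + 1) → M i) → M i) (fun j i v => s j i (Fin.tail v))
        (fun i v => v 0)) (fun j => (ht j).comp_sel (fun _ w => Fin.tail w)) (by
        refine Fin.lastCases ?_ fun j => ?_
        · simp only [Fin.snoc_last]; infer_instance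
        · simp only [Fin.snoc_castSucc]; exact (hs j).comp_sel (fun _ w => Fin.tail w))
    have := this.congr (Q := fun i v => @BoundedFormula.Realize setLang (M i) (memStructure (E i)) α _ φ
      (fun j => t j i (Fin.tail v)) (Fin.snoc (fun j => s j i (Fin.tail v)) (v 0))) (by
        intro i v
        refine iff_of_eq (congr_arg _ ?_)
        funext j
        refine Fin.lastCases ?_ (fun j => ?_) j <;> simp)
    exact IsDef.all (P := fun i v y => @BoundedFormula.Realize setLang (M i) (memStructure (E i)) α _ φ
      (fun j => t j i v) (Fin.snoc (fun j => s j i v) y))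

theorem IsDef.sat {α : Type} (φ : setLang.Formula α)
    (t : α → ∀ i, (Fin n → M i) → M i) (ht : ∀ j, IsDefFun E A (t j)) :
    IsDef E A (fun i v => Sat (E i) φ (fun j => t j i v)) :=
  (IsDef.realize φ t Fin.elim0 ht (fun j => j.elim0)).congr fun i v =>
    iff_of_eq (congr_arg (@BoundedFormula.Realize setLang (M i) (memStructure (E i)) α _ φ
      (fun j => t j i v)) (Subsingleton.elim _ _))

end Definability

/-! ## Set theory inside a model -/

/-- The predicate `P` defines a class of `(V, E)`, with set parameters. -/
abbrev IsCls {V : Type u} (E : V → V → Prop) (P : V → Prop) : Prop :=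
  IsDef (ι := Unit) (M := fun _ => V) (fun _ => E) Set.univ (fun _ (v : Fin 1 → V) => P (v 0))

/-- The binary relation `R` is definable in `(V, E)`, with set parameters. -/
abbrev IsClsRel {V : Type u} (E : V → V → Prop) (R : V → V → Prop) : Prop :=
  IsDef (ι := Unit) (M := fun _ => V) (fun _ => E) Set.univ
    (fun _ (v : Fin 2 → V) => R (v 0) (v 1))

/-- The function `F` is definable in `(V, E)`, with set parameters. -/
abbrev IsClsFun {V : Type u} (E : V → V → Prop) (F : V → V) : Prop :=
  IsDefFun (ι := Unit) (M := fun _ => V) (fun _ => E) Set.univ (fun _ (v : Fin 1 → V) => F (v 0))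

/-- A model of ZFC, with the schemas stated for definable predicates. -/
class SetModel {V : Type u} (E : V → V → Prop) : Prop extends BasicAxioms E where
  separation : ∀ (P : V → Prop) [IsCls E P] (a : V), ∃ b, ∀ x, E x b ↔ E x a ∧ P x
  replacement : ∀ (R : V → V → Prop) [IsClsRel E R] (a : V),
    (∀ x, E x a → ∀ y z, R x y → R x z → y = z) → ∃ b, ∀ y, E y b ↔ ∃ x, E x a ∧ R x y
  class_foundation : ∀ (P : V → Prop) [IsCls E P], (∃ x, P x) → ∃ x, P x ∧ ∀ y, E y x → ¬ P y

theorem SetModel.nonempty {V : Type u} (E : V → V → Prop) [hE : SetModel E] : Nonempty V :=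
  hE.infinity.nonempty

/-- In a single structure the parameters of the uniform formula become constants, so a uniformly
definable family yields definable classes there, whatever `A` is. -/
theorem IsDef.instantiate {ι : Type w} {M : ι → Type u} {E : ∀ i, M i → M i → Prop}
    {A : Set (∀ i, M i)} {n k : ℕ} {Q : ∀ i, (Fin n → M i) → Prop} (h : IsDef E A Q) (i : ι)
    (t : Fin n → (Fin k → M i) → M i)
    (ht : ∀ j, IsDefFun (ι := Unit) (M := fun _ => M i) (fun _ => E i) Set.univ (fun _ => t j)) :
    IsDef (ι := Unit) (M := fun _ => M i) (fun _ => E i) Set.univ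
      (fun _ u => Q i (fun j => t j u)) := by
  obtain ⟨m, φ, c, -, hQ⟩ := h.out
  refine (IsDef.sat (ι := Unit) (M := fun _ => M i) (E := fun _ => E i) φ
    (Sum.elim (fun j _ => t j) (fun j _ _ => c j i)) ?_).congr fun _ u => ?_
  · rintro (j | j)
    · exact ht j
    · exact IsDefFun.const_univ (c := fun _ => c j i)
  · rw [hQ]
    refine iff_of_eq (congr_arg _ ?_)
    funext j
    rcases j with j | j <;> rfl

/-- The set with exactly the elements satisfying `P`, if there is one. -/
noncomputable def mkSet {V : Type u} (E : V → V → Prop) [SetModel E] (P : V → Prop) : V :=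
  @Classical.epsilon V (SetModel.nonempty E) (fun b => ∀ x, E x b ↔ P x)

section Basic

variable {V : Type u} {E : V → V → Prop} [hE : SetModel E]

theorem SetModel.extensional {x y : V} (h : ∀ z, E z x ↔ E z y) : x = y := hE.ext x y h

theorem mem_mkSet {P : V → Prop} (h : ∃ b, ∀ x, E x b ↔ P x) (x : V) : E x (mkSet E P) ↔ P x :=
  Classical.epsilon_spec (p := fun b => ∀ x, E x b ↔ P x) h x

variable (E) in
theorem SetModel.induction (P : V → Prop) [IsCls E P]
    (h : ∀ x, (∀ y, E y x → P y) → P x) (x : V) : P x := by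
  by_contra hx
  obtain ⟨z, hz, hmin⟩ := hE.class_foundation (fun x => ¬ P x) ⟨x, hx⟩
  exact hz (h z fun y hy => not_not.1 (hmin y hy))

theorem not_mem_self (x : V) : ¬ E x x :=
  SetModel.induction E (fun x => ¬ E x x) (fun x ih hx => ih x hx hx) x

theorem mem_asymm {x y : V} (h : E x y) : ¬ E y x :=
  SetModel.induction E (fun x => ∀ y, E x y → ¬ E y x)
    (fun x ih y hxy hyx => ih y hyx x hyx hxy) x y h

end Basic

section Operations

variable {V : Type u} (E : V → V → Prop) [hE : SetModel E]

/-- The set `{x, y}`. -/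
noncomputable def upair (x y : V) : V := mkSet E (fun z => z = x ∨ z = y)
/-- The Kuratowski pair. -/
noncomputable def opair (x y : V) : V := upair E (upair E x x) (upair E x y)
/-- The union of the elements of `x`. -/
noncomputable def bigUnion (x : V) : V := mkSet E (fun z => ∃ y, E y x ∧ E z y)
/-- The power set. -/
noncomputable def pset (x : V) : V := mkSet E (fun z => IsSub E z x)
/-- The subset of `a` defined by `P`. -/
noncomputable def sep (a : V) (P : V → Prop) : V := mkSet E (fun z => E z a ∧ P z)
/-- The set of the values of `F` on the elements of `a`. -/
noncomputable def image (a : V) (F : V → V) : V := mkSet E (fun z => ∃ x, E x a ∧ z = F x)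
/-- The empty set. -/
noncomputable def emptySet : V := mkSet E (fun _ => False)
/-- `x ∪ {y}`. -/
noncomputable def insertSet (x y : V) : V := mkSet E (fun z => E z x ∨ z = y)
/-- The value of the function `f` at `a`; the definition makes sense for all sets `f`. -/
noncomputable def app (f a : V) : V := mkSet E (fun z => ∃ y, E (opair E a y) f ∧ E z y)
/-- The restriction of `F` to `a` as a set function. -/
noncomputable def graphOn (a : V) (F : V → V) : V := image E a (fun x => opair E x (F x))
/-- The Cartesian product. -/
noncomputable def prodSet (a b : V) : V := mkSet E (fun z => ∃ x, E x a ∧ ∃ y, E y b ∧ z = opair E x y)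

end Operations

section OperationLemmas

variable {V : Type u} {E : V → V → Prop} [hE : SetModel E]

theorem mem_upair {x y z : V} : E z (upair E x y) ↔ z = x ∨ z = y := mem_mkSet (hE.pairing x y) z

theorem mem_bigUnion {x z : V} : E z (bigUnion E x) ↔ ∃ y, E y x ∧ E z y := mem_mkSet (hE.union x) z

theorem mem_pset {x z : V} : E z (pset E x) ↔ IsSub E z x := mem_mkSet (hE.powerset x) z

theorem mem_sep {a : V} {P : V → Prop} [IsCls E P] {z : V} : E z (sep E a P) ↔ E z a ∧ P z :=
  mem_mkSet (hE.separation P a) z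

theorem mem_emptySet {z : V} : ¬ E z (emptySet E) := by
  obtain ⟨w, ⟨e, he, -⟩, -⟩ := hE.infinity
  exact fun h => (mem_mkSet (P := fun _ => False) ⟨e, fun x => iff_false_intro (he x)⟩ z).1 h

theorem mem_insertSet {x y z : V} : E z (insertSet E x y) ↔ E z x ∨ z = y := by
  refine mem_mkSet ⟨bigUnion E (upair E x (upair E y y)), fun _ => ?_⟩ z
  simp [mem_bigUnion, mem_upair]

theorem upair_inj {x y z w : V} (h : upair E x y = upair E z w) : (x = z ∧ y = w) ∨ (x = w ∧ y = z) := by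
  have hx : x = z ∨ x = w := mem_upair.1 (h ▸ (mem_upair (E := E)).2 (Or.inl rfl))
  have hy : y = z ∨ y = w := mem_upair.1 (h ▸ (mem_upair (E := E)).2 (Or.inr rfl))
  have hz : z = x ∨ z = y := mem_upair.1 (h.symm ▸ (mem_upair (E := E)).2 (Or.inl rfl))
  have hw : w = x ∨ w = y := mem_upair.1 (h.symm ▸ (mem_upair (E := E)).2 (Or.inr rfl))
  grind

theorem opair_inj {x y z w : V} : opair E x y = opair E z w ↔ x = z ∧ y = w := by
  refine ⟨fun h => ?_, fun h => by rw [h.1, h.2]⟩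
  rcases upair_inj h with ⟨h1, h2⟩ | ⟨h1, h2⟩
  · have h3 := upair_inj h1
    have h4 := upair_inj h2
    grind
  · have h3 := upair_inj h1
    have h4 := upair_inj h2
    grind

theorem isUPair_iff {p x y : V} : IsUPair E p x y ↔ p = upair E x y :=
  ⟨fun h => hE.extensional fun z => (h z).trans mem_upair.symm, fun h z => h ▸ mem_upair⟩

theorem isPair_iff {p x y : V} : IsPair E p x y ↔ p = opair E x y := by
  simp only [IsPair, isUPair_iff]
  exact ⟨fun h => hE.extensional fun z => (h z).trans mem_upair.symm, fun h z => h ▸ mem_upair⟩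

theorem pairIn_iff {f x y : V} : PairIn E f x y ↔ E (opair E x y) f := by
  simp [PairIn, isPair_iff]

theorem isSucc_iff {s x : V} : IsSucc E s x ↔ s = insertSet E x x :=
  ⟨fun h => hE.extensional fun z => (h z).trans mem_insertSet.symm, fun h z => h ▸ mem_insertSet⟩

theorem mem_image {a z : V} {F : V → V} [hF : IsClsFun E F] :
    E z (image E a F) ↔ ∃ x, E x a ∧ z = F x := by
  have : IsClsRel E (fun x y => y = F x) :=
    hF.graph.comp_sel (fun _ w => w ∘ ![1, 0]) (hs := ⟨⟨_, fun _ _ => rfl⟩⟩)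
  exact mem_mkSet (hE.replacement (fun x y => y = F x) a (by grind)) z

end OperationLemmas

section OperationDef

variable {ι : Type w} {M : ι → Type u} {E : ∀ i, M i → M i → Prop} {A : Set (∀ i, M i)} {n : ℕ}

theorem isCls_instantiate {P : ∀ i, (Fin n → M i) → M i → Prop}
    (h : IsDef E A (n := n + 1) (fun i w => P i (Fin.tail w) (w 0))) (i : ι) (v : Fin n → M i) :
    IsCls (E i) (P i v) :=
  h.instantiate i (Fin.cons (α := fun _ => (Fin 1 → M i) → M i) (fun u => u 0) (fun j _ => v j))
    (Fin.cases (IsDefFun.var (s := fun _ u => u) 0) fun j => IsDefFun.const_univ (c := fun _ => v j))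

theorem isClsFun_instantiate {F : ∀ i, (Fin n → M i) → M i → M i}
    (h : IsDefFun E A (n := n + 1) (fun i w => F i (Fin.tail w) (w 0))) (i : ι) (v : Fin n → M i) :
    IsClsFun (E i) (F i v) :=
  ⟨h.graph.instantiate i (Fin.cons (α := fun _ => (Fin 2 → M i) → M i) (fun u => u 0)
    (Fin.cons (α := fun _ => (Fin 2 → M i) → M i) (fun u => u 1) (fun j _ => v j)))
    (Fin.cases (IsDefFun.var (s := fun _ u => u) 0) (Fin.cases (IsDefFun.var (s := fun _ u => u) 1)
      fun j => IsDefFun.const_univ (c := fun _ => v j)))⟩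

variable [hE : ∀ i, SetModel (E i)]

theorem isDefFun_mkSet {P : ∀ i, (Fin n → M i) → M i → Prop}
    [IsDef E A (n := n + 1) (fun i w => P i (Fin.tail w) (w 0))]
    (h : ∀ i v, ∃ b, ∀ x, E i x b ↔ P i v x) : IsDefFun E A (fun i v => mkSet (E i) (P i v)) := by
  have : IsDef E A (n := n + 2) (fun i w => P i (Fin.tail (Fin.tail w)) (w 0)) :=
    (‹IsDef E A (n := n + 1) (fun i w => P i (Fin.tail w) (w 0))›).comp_sel
      (fun i w => w ∘ (Fin.cases 0 (fun k => k.succ.succ) : Fin (n + 1) → _))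
      (hs := ⟨⟨_, fun _ _ => rfl⟩⟩)
  have h' : IsDef E A (n := n + 1) (fun i w => ∀ z, (E i z (w 0) ↔ P i (Fin.tail w) z)) := inferInstance
  refine ⟨h'.congr fun i w => ?_⟩
  constructor
  · intro hw z
    rw [hw]
    exact mem_mkSet (h i _) z
  · intro hw
    exact (hE i).extensional fun z => (hw z).trans (mem_mkSet (h i _) z).symm

instance IsDefFun.upair {a b : ∀ i, (Fin n → M i) → M i} [IsDefFun E A a] [IsDefFun E A b] :
    IsDefFun E A (fun i v => upair (E i) (a i v) (b i v)) :=
  isDefFun_mkSet fun i _ => (hE i).pairing _ _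

instance IsDefFun.opair {a b : ∀ i, (Fin n → M i) → M i} [IsDefFun E A a] [IsDefFun E A b] :
    IsDefFun E A (fun i v => opair (E i) (a i v) (b i v)) := by
  unfold InnerModelReflect.opair
  infer_instance

instance IsDefFun.bigUnion {a : ∀ i, (Fin n → M i) → M i} [IsDefFun E A a] :
    IsDefFun E A (fun i v => bigUnion (E i) (a i v)) :=
  isDefFun_mkSet fun i _ => (hE i).union _

instance IsDefFun.pset {a : ∀ i, (Fin n → M i) → M i} [IsDefFun E A a] :
    IsDefFun E A (fun i v => pset (E i) (a i v)) :=
  isDefFun_mkSet fun i _ => (hE i).powerset _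

instance IsDefFun.insertSet {a b : ∀ i, (Fin n → M i) → M i} [IsDefFun E A a] [IsDefFun E A b] :
    IsDefFun E A (fun i v => insertSet (E i) (a i v) (b i v)) :=
  isDefFun_mkSet fun i v => ⟨InnerModelReflect.insertSet (E i) (a i v) (b i v), fun _ => mem_insertSet⟩

instance IsDefFun.sep {a : ∀ i, (Fin n → M i) → M i} {P : ∀ i, (Fin n → M i) → M i → Prop}
    [IsDefFun E A a] [h : IsDef E A (n := n + 1) (fun i w => P i (Fin.tail w) (w 0))] :
    IsDefFun E A (fun i v => sep (E i) (a i v) (fun x => P i v x)) :=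
  isDefFun_mkSet fun i v =>
    have := isCls_instantiate h i v
    (hE i).separation (P i v) (a i v)

instance IsDefFun.image {a : ∀ i, (Fin n → M i) → M i} {F : ∀ i, (Fin n → M i) → M i → M i}
    [IsDefFun E A a] [h : IsDefFun E A (n := n + 1) (fun i w => F i (Fin.tail w) (w 0))] :
    IsDefFun E A (fun i v => image (E i) (a i v) (fun x => F i v x)) := by
  have : IsDefFun E A (n := n + 2) (fun i w => F i (Fin.tail (Fin.tail w)) (w 0)) :=
    h.comp_sel (fun i w => w ∘ (Fin.cases 0 (fun k => k.succ.succ) : Fin (n + 1) → _))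
      (hs := ⟨⟨_, fun _ _ => rfl⟩⟩)
  refine isDefFun_mkSet fun i v => ⟨InnerModelReflect.image (E i) (a i v) (F i v), fun x => ?_⟩
  have := isClsFun_instantiate h i v
  exact mem_image (F := F i v)

instance IsDefFun.graphOn {a : ∀ i, (Fin n → M i) → M i} {F : ∀ i, (Fin n → M i) → M i → M i}
    [IsDefFun E A a] [h : IsDefFun E A (n := n + 1) (fun i w => F i (Fin.tail w) (w 0))] :
    IsDefFun E A (fun i v => graphOn (E i) (a i v) (fun x => F i v x)) := by
  unfold InnerModelReflect.graphOn
  infer_instance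

end OperationDef

section AppLemmas

variable {V : Type u} {E : V → V → Prop}

theorem IsClsFun.comp {F : V → V} (hF : IsClsFun E F) {n : ℕ}
    (a : Unit → (Fin n → V) → V)
    [IsDefFun (ι := Unit) (M := fun _ => V) (fun _ => E) Set.univ a] :
    IsDefFun (ι := Unit) (M := fun _ => V) (fun _ => E) Set.univ (fun i v => F (a i v)) :=
  IsDefFun.comp₁ (M := fun _ => V) (f := fun _ => F) hF.graph

theorem IsCls.comp {P : V → Prop} (hP : IsCls E P) {n : ℕ} (a : Unit → (Fin n → V) → V)
    [IsDefFun (ι := Unit) (M := fun _ => V) (fun _ => E) Set.univ a] :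
    IsDef (ι := Unit) (M := fun _ => V) (fun _ => E) Set.univ (fun i v => P (a i v)) :=
  IsDef.comp₁ (M := fun _ => V) (R := fun _ => P) hP

theorem IsClsRel.comp {R : V → V → Prop} (hR : IsClsRel E R) {n : ℕ}
    (a b : Unit → (Fin n → V) → V)
    [IsDefFun (ι := Unit) (M := fun _ => V) (fun _ => E) Set.univ a]
    [IsDefFun (ι := Unit) (M := fun _ => V) (fun _ => E) Set.univ b] :
    IsDef (ι := Unit) (M := fun _ => V) (fun _ => E) Set.univ (fun i v => R (a i v) (b i v)) :=
  IsDef.comp₂ (M := fun _ => V) (R := fun _ => R) hR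

variable [hE : SetModel E]

theorem mem_opair {x y z : V} : E z (opair E x y) ↔ z = upair E x x ∨ z = upair E x y := mem_upair

theorem mem_app {f a z : V} : E z (app E f a) ↔ ∃ y, E (opair E a y) f ∧ E z y := by
  -- The chain `z ∈ y ∈ {a, y} ∈ (a, y) ∈ f` accounts for the three unions.
  refine mem_mkSet ⟨sep E (bigUnion E (bigUnion E (bigUnion E f)))
    (fun z => ∃ y, E (opair E a y) f ∧ E z y), fun z => ?_⟩ z
  simp only [mem_sep]
  refine and_iff_right_of_imp ?_
  rintro ⟨y, hy, hz⟩
  refine mem_bigUnion.2 ⟨y, mem_bigUnion.2 ⟨upair E a y, mem_bigUnion.2 ⟨_, hy, ?_⟩, ?_⟩, hz⟩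
  · exact mem_opair.2 (Or.inr rfl)
  · exact mem_upair.2 (Or.inr rfl)

theorem app_eq {f a y : V} (h : ∀ z, E (opair E a z) f ↔ z = y) : app E f a = y :=
  hE.extensional fun z => by simp [mem_app, h]

theorem mem_graphOn {a p : V} {F : V → V} [hF : IsClsFun E F] :
    E p (graphOn E a F) ↔ ∃ x, E x a ∧ p = opair E x (F x) := by
  exact mem_image

theorem app_graphOn {a x : V} {F : V → V} [hF : IsClsFun E F] (hx : E x a) :
    app E (graphOn E a F) x = F x :=
  app_eq fun z => by
    simp only [mem_graphOn]
    constructor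
    · rintro ⟨x', _, h⟩
      obtain ⟨rfl, rfl⟩ := opair_inj.1 h
      rfl
    · rintro rfl
      exact ⟨x, hx, rfl⟩

theorem isFunOn_graphOn {a : V} {F : V → V} [hF : IsClsFun E F] : IsFunOn E (graphOn E a F) a := by
  simp only [IsFunOn, isPair_iff, pairIn_iff, mem_graphOn, opair_inj]
  exact ⟨fun p ⟨x, hx, h⟩ => ⟨x, F x, hx, h⟩, fun x hx => ⟨F x, ⟨x, hx, rfl, rfl⟩, by grind⟩⟩

theorem IsFunOn.opair_mem_iff {f d x : V} (h : IsFunOn E f d) (hx : E x d) (y : V) :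
    E (opair E x y) f ↔ y = app E f x := by
  obtain ⟨z, hz, huniq⟩ := h.2 x hx
  simp only [pairIn_iff] at hz huniq
  have : app E f x = z := app_eq fun y => ⟨huniq y, fun h => h ▸ hz⟩
  rw [this]
  exact ⟨huniq y, fun h => h ▸ hz⟩

theorem mem_prodSet {a b p : V} :
    E p (prodSet E a b) ↔ ∃ x, E x a ∧ ∃ y, E y b ∧ p = opair E x y := by
  refine mem_mkSet ⟨bigUnion E (image E a (fun x => image E b (fun y => opair E x y))),
    fun p => ?_⟩ p
  have h1 : ∀ x, IsClsFun E (fun y => opair E x y) := fun x =>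
    have := IsDefFun.const_univ (E := fun _ : Unit => E) (n := 1) (c := fun _ => x)
    inferInstance
  have h2 : IsClsFun E (fun x => image E b (fun y => opair E x y)) :=
    have := IsDefFun.const_univ (E := fun _ : Unit => E) (n := 1) (c := fun _ => b)
    inferInstance
  rw [mem_bigUnion (E := E)]
  constructor
  · rintro ⟨y, hy, hp⟩
    obtain ⟨x, hx, rfl⟩ := mem_image.1 hy
    obtain ⟨y, hy, rfl⟩ := mem_image.1 hp
    exact ⟨x, hx, y, hy, rfl⟩
  · rintro ⟨x, hx, y, hy, rfl⟩
    exact ⟨_, mem_image.2 ⟨x, hx, rfl⟩, mem_image.2 ⟨y, hy, rfl⟩⟩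

end AppLemmas

section AppDef

variable {ι : Type w} {M : ι → Type u} {E : ∀ i, M i → M i → Prop} {A : Set (∀ i, M i)} {n : ℕ}
  [hE : ∀ i, SetModel (E i)]

instance IsDefFun.app {a b : ∀ i, (Fin n → M i) → M i} [IsDefFun E A a] [IsDefFun E A b] :
    IsDefFun E A (fun i v => app (E i) (a i v) (b i v)) :=
  isDefFun_mkSet fun i v => ⟨InnerModelReflect.app (E i) (a i v) (b i v), fun _ => mem_app⟩

instance IsDefFun.prodSet {a b : ∀ i, (Fin n → M i) → M i} [IsDefFun E A a] [IsDefFun E A b] :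
    IsDefFun E A (fun i v => prodSet (E i) (a i v) (b i v)) :=
  isDefFun_mkSet fun i v => ⟨InnerModelReflect.prodSet (E i) (a i v) (b i v), fun _ => mem_prodSet⟩

end AppDef

/-! ## Ordinals, recursion and the cumulative hierarchy -/

section Ordinals

variable {V : Type u} {E : V → V → Prop} [hE : SetModel E]

omit hE in
theorem IsOrd.mem {α β : V} (hα : IsOrd E α) (h : E β α) : IsOrd E β :=
  ⟨hα.2 β h, fun x hx => hα.2 x (hα.1 β h x hx)⟩

omit hE in
theorem IsOrd.trans {α β γ : V} (hα : IsOrd E α) (h : E β α) (h' : E γ β) : E γ α := hα.1 β h γ h'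

theorem IsOrd.trichotomy {α β : V} (hα : IsOrd E α) (hβ : IsOrd E β) :
    E α β ∨ α = β ∨ E β α := by
  refine SetModel.induction E
    (fun α => IsOrd E α → ∀ β, IsOrd E β → E α β ∨ α = β ∨ E β α) ?_ α hα β hβ
  intro α ihα hα
  refine SetModel.induction E (fun β => IsOrd E β → E α β ∨ α = β ∨ E β α) fun β ihβ hβ => ?_
  by_cases h1 : ∃ γ, E γ β ∧ (E α γ ∨ α = γ)
  · obtain ⟨γ, hγ, h | rfl⟩ := h1
    · exact Or.inl (hβ.trans hγ h)
    · exact Or.inl hγ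
  by_cases h2 : ∃ γ, E γ α ∧ (γ = β ∨ E β γ)
  · obtain ⟨γ, hγ, rfl | h⟩ := h2
    · exact Or.inr (Or.inr hγ)
    · exact Or.inr (Or.inr (hα.trans hγ h))
  refine Or.inr (Or.inl (hE.extensional fun z => ⟨fun hz => ?_, fun hz => ?_⟩))
  · have := ihα z hz (hα.mem hz) β hβ
    grind
  · have := ihβ z hz (hβ.mem hz)
    grind

theorem IsOrd.succ {α : V} (hα : IsOrd E α) : IsOrd E (insertSet E α α) := by
  constructor
  · intro x hx y hy
    rcases mem_insertSet.1 hx with h | rfl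
    · exact mem_insertSet.2 (Or.inl (hα.trans h hy))
    · exact mem_insertSet.2 (Or.inl hy)
  · intro x hx
    rcases mem_insertSet.1 hx with h | rfl
    · exact hα.2 x h
    · exact hα.1

theorem isOrd_bigUnion {a : V} (ha : ∀ α, E α a → IsOrd E α) : IsOrd E (bigUnion E a) := by
  constructor
  · intro x hx y hy
    obtain ⟨α, hα, h⟩ := mem_bigUnion.1 hx
    exact mem_bigUnion.2 ⟨α, hα, (ha α hα).trans h hy⟩
  · intro x hx
    obtain ⟨α, hα, h⟩ := mem_bigUnion.1 hx
    exact (ha α hα).2 x h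

theorem isTransSet_insertSet_self {x : V} (hx : IsTransSet E x) : IsTransSet E (insertSet E x x) := by
  intro y hy z hz
  rcases mem_insertSet.1 hy with h | rfl
  · exact mem_insertSet.2 (Or.inl (hx y h z hz))
  · exact mem_insertSet.2 (Or.inl hz)

/-- Assigning to `x` its least suitable ordinal is functional, so replacement applies. Successors
are taken before the union to make the bound strict. -/
theorem exists_ord_bound (R : V → V → Prop) [hR : IsClsRel E R] (a : V)
    (h : ∀ x, E x a → ∃ α, IsOrd E α ∧ R x α) :
    ∃ θ, IsOrd E θ ∧ ∀ x, E x a → ∃ α, E α θ ∧ R x α := by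
  have hR' := fun {n} => hR.comp (n := n)
  obtain ⟨b, hb⟩ := hE.replacement (fun x α => IsOrd E α ∧ R x α ∧ ∀ β, E β α → ¬ R x β) a
    fun x _ y z hy hz => by
      rcases hy.1.trichotomy hz.1 with h | h | h
      · exact absurd hy.2.1 (hz.2.2 y h)
      · exact h
      · exact absurd hz.2.1 (hy.2.2 z h)
  refine ⟨bigUnion E (image E b (fun α => insertSet E α α)), isOrd_bigUnion ?_, fun x hx => ?_⟩
  · intro β hβ
    obtain ⟨α, hα, rfl⟩ := mem_image.1 hβ
    obtain ⟨x, -, hx, -⟩ := (hb α).1 hα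
    exact hx.succ
  · obtain ⟨α, hα, hmin⟩ := hE.class_foundation (fun α => IsOrd E α ∧ R x α) (h x hx)
    refine ⟨α, mem_bigUnion.2 ⟨_, mem_image.2 ⟨α, (hb α).2 ⟨x, hx, hα.1, hα.2, fun β hβ hxβ => ?_⟩,
      rfl⟩, mem_insertSet.2 (Or.inr rfl)⟩, hα.2⟩
    exact hmin β hβ ⟨hα.1.mem hβ, hxβ⟩

end Ordinals

/-! ### Recursion along well-founded definable relations on a set -/

section Recursion

variable {V : Type u} {E : V → V → Prop} [hE : SetModel E]

theorem image_congr {a : V} {F G : V → V} (h : ∀ x, E x a → F x = G x) : image E a F = image E a G := by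
  unfold image
  congr 1
  funext z
  exact propext ⟨fun ⟨x, hx, hz⟩ => ⟨x, hx, hz.trans (h x hx)⟩,
    fun ⟨x, hx, hz⟩ => ⟨x, hx, hz.trans (h x hx).symm⟩⟩

/-- Any two approximations agree on the intersection of their domains, by a minimal disagreement, so
their values can be collected into one `c`. A minimal point not covered by `c` could be added, hence
there is none. `S` need not be transitive or extensional; this generality serves the cumulative
hierarchy, descending sequences and the collapse alike. -/
theorem exists_recursion (d : V) (S : V → V → Prop) [hS : IsClsRel E S] (G : V → V)
    [hG : IsClsFun E G]
    (wf : ∀ e, IsSub E e d → (∃ x, E x e) → ∃ x, E x e ∧ ∀ y, E y e → ¬ S y x) :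
    ∃ c, ∀ x, E x d → app E c x = G (image E (sep E d (fun y => S y x)) (fun y => app E c y)) := by
  have hS' := fun {n} => hS.comp (n := n)
  have hG' := fun {n} => hG.comp (n := n)
  let H : V → V → V := fun c x => image E (sep E d (fun y => S y x)) (fun y => app E c y)
  have hH : ∀ c c' x, (∀ y, E y d → S y x → app E c y = app E c' y) → H c x = H c' x :=
    fun c c' x h => image_congr fun y hy => h y (mem_sep.1 hy).1 (mem_sep.1 hy).2
  -- An approximation lives on a set `e` closed under `S`-predecessors, so the recursion equation on
  -- `e` refers only to values on `e`.
  let Ap : V → V → Prop := fun e c => IsSub E e d ∧ (∀ x, E x e → ∀ y, E y d → S y x → E y e) ∧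
    ∀ x, E x e → app E c x = G (H c x)
  have hAp : IsClsRel E Ap := by
    dsimp only [Ap, H]
    infer_instance
  have agree : ∀ e c e' c' x, Ap e c → Ap e' c' → E x e → E x e' → app E c x = app E c' x := by
    intro e c e' c' x h h' hx hx'
    by_contra hne
    obtain ⟨y, hy, hmin⟩ := wf (sep E e (fun x => E x e' ∧ app E c x ≠ app E c' x))
      (fun y hy => h.1 y (mem_sep.1 hy).1) ⟨x, mem_sep.2 ⟨hx, hx', hne⟩⟩
    obtain ⟨hye, hye', hne⟩ := mem_sep.1 hy
    refine hne ?_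
    rw [h.2.2 y hye, h'.2.2 y hye', hH c c' y]
    intro z hzd hzy
    by_contra hz
    exact hmin z (mem_sep.2 ⟨h.2.1 y hye z hzd hzy, h'.2.1 y hye' z hzd hzy, hz⟩) hzy
  let Val : V → V → Prop := fun x y => ∃ e c, Ap e c ∧ E x e ∧ y = app E c x
  have hVal : IsClsRel E Val := by
    dsimp only [Val]
    infer_instance
  have Val_unique : ∀ x y y', Val x y → Val x y' → y = y' := by
    rintro x _ _ ⟨e, c, h, hx, rfl⟩ ⟨e', c', h', hx', rfl⟩
    exact agree e c e' c' x h h' hx hx'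
  obtain ⟨c, hc⟩ := hE.replacement (fun x p => ∃ y, Val x y ∧ p = opair E x y) d (by
    rintro x - _ _ ⟨y, hy, rfl⟩ ⟨y', hy', rfl⟩
    rw [Val_unique x y y' hy hy'])
  have hcmem : ∀ x y, E (opair E x y) c ↔ E x d ∧ Val x y := fun x y => by
    rw [hc]
    constructor
    · rintro ⟨x', hx', y', hy', h⟩
      obtain ⟨rfl, rfl⟩ := opair_inj.1 h
      exact ⟨hx', hy'⟩
    · rintro ⟨hx, hy⟩
      exact ⟨x, hx, y, hy, rfl⟩
  have hcapp : ∀ x y, E x d → Val x y → app E c x = y := fun x y hx hy =>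
    app_eq fun z => by
      rw [hcmem]
      exact ⟨fun h => Val_unique x z y h.2 hy, fun h => ⟨hx, h ▸ hy⟩⟩
  let e := sep E d (fun x => ∃ y, Val x y)
  have he : ∀ x, E x e ↔ E x d ∧ ∃ y, Val x y := fun x => mem_sep
  have hec : Ap e c := by
    refine ⟨fun x hx => ((he x).1 hx).1, ?_, ?_⟩
    · intro x hx y hy hyx
      obtain ⟨hxd, z, e', c', h, hxe, rfl⟩ := (he x).1 hx
      exact (he y).2 ⟨hy, _, e', c', h, h.2.1 x hxe y hy hyx, rfl⟩
    · intro x hx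
      obtain ⟨hxd, z, e', c', h, hxe, rfl⟩ := (he x).1 hx
      rw [hcapp x _ hxd ⟨e', c', h, hxe, rfl⟩, h.2.2 x hxe, hH c' c x]
      intro y hy hyx
      exact (hcapp y _ hy ⟨e', c', h, h.2.1 x hxe y hy hyx, rfl⟩).symm
  refine ⟨c, fun x hx => hec.2.2 x ?_⟩
  by_contra hxe
  obtain ⟨x, hx, hmin⟩ := wf (sep E d (fun x => ¬ E x e)) (fun x hx => (mem_sep.1 hx).1)
    ⟨x, mem_sep.2 ⟨hx, hxe⟩⟩
  obtain ⟨hxd, hxe⟩ := mem_sep.1 hx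
  have hpred : ∀ y, E y d → S y x → E y e := fun y hy hyx => by
    by_contra hye
    exact hmin y (mem_sep.2 ⟨hy, hye⟩) hyx
  -- All predecessors of the minimal uncovered `x` are covered, so the value at `x` is forced and
  -- `c'` is an approximation on `e ∪ {x}`.
  let c' := insertSet E c (opair E x (G (H c x)))
  have hc'mem : ∀ y z, E (opair E y z) c' ↔ E (opair E y z) c ∨ (y = x ∧ z = G (H c x)) := by
    intro y z
    simp only [c', mem_insertSet, opair_inj]
  have hc'e : ∀ y, E y e → app E c' y = app E c y := fun y hy =>
    app_eq fun z => by
      obtain ⟨hyd, z', hz'⟩ := (he y).1 hy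
      rw [hc'mem, hcmem, hcapp y z' hyd hz']
      constructor
      · rintro (h | ⟨rfl, -⟩)
        · exact Val_unique y z z' h.2 hz'
        · exact absurd hy hxe
      · rintro rfl
        exact Or.inl ⟨hyd, hz'⟩
  have hc'x : app E c' x = G (H c x) :=
    app_eq fun z => by
      rw [hc'mem, hcmem]
      constructor
      · rintro (h | ⟨-, rfl⟩)
        · exact absurd ((he x).2 ⟨h.1, z, h.2⟩) hxe
        · rfl
      · rintro rfl
        exact Or.inr ⟨rfl, rfl⟩
  have hH' : ∀ y, (E y e ∨ y = x) → H c' y = H c y := by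
    intro y hy
    refine hH c' c y fun z hz hzy => hc'e z ?_
    rcases hy with hy | rfl
    · exact hec.2.1 y hy z hz hzy
    · exact hpred z hz hzy
  have hAp' : Ap (insertSet E e x) c' := by
    refine ⟨?_, ?_, ?_⟩
    · intro y hy
      rcases mem_insertSet.1 hy with h | rfl
      · exact hec.1 y h
      · exact hxd
    · intro y hy z hz hzy
      refine mem_insertSet.2 (Or.inl ?_)
      rcases mem_insertSet.1 hy with h | rfl
      · exact hec.2.1 y h z hz hzy
      · exact hpred z hz hzy
    · intro y hy
      rw [hH' y (mem_insertSet.1 hy)]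
      rcases mem_insertSet.1 hy with h | rfl
      · rw [hc'e y h, hec.2.2 y h]
      · exact hc'x
  exact hxe ((he x).2 ⟨hxd, _, _, c', hAp', mem_insertSet.2 (Or.inr rfl), rfl⟩)

/-- By `∈`-induction the closure of `x` is `x` together with the closures of its elements. The
minimality clause makes the closure unique, as replacement requires. -/
theorem exists_transitive_closure (x : V) : ∃ t, IsTransSet E t ∧ IsSub E x t ∧
    ∀ t', IsTransSet E t' → IsSub E x t' → IsSub E t t' := by
  refine SetModel.induction E (fun x => ∃ t, IsTransSet E t ∧ IsSub E x t ∧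
    ∀ t', IsTransSet E t' → IsSub E x t' → IsSub E t t') (fun x ih => ?_) x
  let R : V → V → Prop := fun x t => IsTransSet E t ∧ IsSub E x t ∧
    ∀ t', IsTransSet E t' → IsSub E x t' → IsSub E t t'
  have hR : IsClsRel E R := by
    dsimp only [R]
    infer_instance
  obtain ⟨b, hb⟩ := hE.replacement R x fun y _ t t' ht ht' =>
    hE.extensional fun z => ⟨ht.2.2 t' ht'.1 ht'.2.1 z, ht'.2.2 t ht.1 ht.2.1 z⟩
  have hmem : ∀ z, E z (bigUnion E (upair E x (bigUnion E b))) ↔ E z x ∨ ∃ y t, E y x ∧ R y t ∧ E z t := by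
    intro z
    simp only [mem_bigUnion, mem_upair, exists_eq_or_imp, exists_eq_left, hb]
    grind
  refine ⟨bigUnion E (upair E x (bigUnion E b)), ?_, fun z hz => (hmem z).2 (Or.inl hz), ?_⟩
  · intro y hy z hz
    rcases (hmem y).1 hy with h | ⟨y', t, hy', ht, hyt⟩
    · obtain ⟨t, ht⟩ := ih y h
      exact (hmem z).2 (Or.inr ⟨y, t, h, ht, ht.2.1 z hz⟩)
    · exact (hmem z).2 (Or.inr ⟨y', t, hy', ht, ht.1 y hyt z hz⟩)
  · intro t' ht' hx z hz
    rcases (hmem z).1 hz with h | ⟨y, t, hy, ht, hzt⟩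
    · exact hx z h
    · exact ht.2.2 t' ht' (ht' y (hx y hy)) z hzt

end Recursion

/-! ### The cumulative hierarchy, collection and choice for definable relations -/

section Hierarchy

variable {V : Type u} (E : V → V → Prop) [hE : SetModel E]

/-- The function `h` is the cumulative hierarchy on the transitive set `s`. -/
def IsHierarchyOn (h s : V) : Prop :=
  IsTransSet E s ∧ ∀ β, E β s → ∀ x, E x (app E h β) ↔ ∃ γ, E γ β ∧ IsSub E x (app E h γ)

/-- `V_α` as a function of the ordinal `α`. -/
noncomputable def level (α : V) : V := mkSet E (MemVLevel E α)

variable {E}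

theorem exists_isHierarchyOn {s : V} (hs : IsTransSet E s) : ∃ h, IsHierarchyOn E h s := by
  obtain ⟨c, hc⟩ := exists_recursion (E := E) s E (fun w => bigUnion E (image E w (fun z => pset E z)))
    fun e _ he => by
      obtain ⟨x, hx, hmin⟩ := hE.foundation e he
      exact ⟨x, hx, fun y hy hyx => hmin y hyx hy⟩
  refine ⟨c, hs, fun β hβ x => ?_⟩
  rw [hc β hβ]
  simp only [mem_bigUnion]
  constructor
  · rintro ⟨y, hy, hx⟩
    obtain ⟨z, hz, rfl⟩ := mem_image.1 hy
    obtain ⟨γ, hγ, rfl⟩ := mem_image.1 hz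
    exact ⟨γ, (mem_sep.1 hγ).2, mem_pset.1 hx⟩
  · rintro ⟨γ, hγ, hx⟩
    exact ⟨_, mem_image.2 ⟨_, mem_image.2 ⟨γ, mem_sep.2 ⟨hs β hβ γ hγ, hγ⟩, rfl⟩, rfl⟩, mem_pset.2 hx⟩

theorem IsHierarchyOn.agree {h s h' s' : V} (hh : IsHierarchyOn E h s) (hh' : IsHierarchyOn E h' s')
    (β : V) : E β s → E β s' → app E h β = app E h' β := by
  refine SetModel.induction E (fun β => E β s → E β s' → app E h β = app E h' β)
    (fun β ih hβ hβ' => ?_) β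
  refine hE.extensional fun x => ?_
  rw [hh.2 β hβ, hh'.2 β hβ']
  refine exists_congr fun γ => and_congr_right fun hγ => ?_
  rw [ih γ hγ (hh.1 β hβ γ hγ) (hh'.1 β hβ' γ hγ)]

theorem IsHierarchyOn.isVLevel {h s κ : V} (hh : IsHierarchyOn E h s) (hκ : E κ s)
    (hκt : IsTransSet E κ) : IsVLevel E κ (app E h κ) := by
  have hsub : ∀ x, E x (insertSet E κ κ) → E x s := by
    intro x hx
    rcases mem_insertSet.1 hx with h | rfl
    · exact hh.1 κ hκ x h
    · exact hκ
  have hmem : ∀ x y, PairIn E (graphOn E (insertSet E κ κ) (fun x => app E h x)) x y ↔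
      E x (insertSet E κ κ) ∧ y = app E h x := by
    intro x y
    rw [pairIn_iff (E := E)]
    refine mem_graphOn.trans ⟨?_, ?_⟩
    · rintro ⟨x', hx', h⟩
      obtain ⟨rfl, rfl⟩ := opair_inj.1 h
      exact ⟨hx', rfl⟩
    · rintro ⟨hx, rfl⟩
      exact ⟨x, hx, rfl⟩
  refine ⟨graphOn E (insertSet E κ κ) (fun x => app E h x), insertSet E κ κ, isSucc_iff.2 rfl,
    isFunOn_graphOn, fun β y hβ x => ?_, (hmem _ _).2 ⟨mem_insertSet.2 (Or.inr rfl), rfl⟩⟩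
  obtain ⟨hβs, rfl⟩ := (hmem β y).1 hβ
  rw [hh.2 β (hsub β hβs)]
  refine exists_congr fun γ => ⟨fun ⟨hγ, hx⟩ => ⟨_, hγ, (hmem _ _).2 ⟨?_, rfl⟩, hx⟩, ?_⟩
  · exact isTransSet_insertSet_self hκt β hβs γ hγ
  · rintro ⟨z, hγ, hz, hx⟩
    obtain ⟨-, rfl⟩ := (hmem _ _).1 hz
    exact ⟨hγ, hx⟩

theorem IsVLevel.exists_hierarchy {κ v : V} (h : IsVLevel E κ v) (hκ : IsTransSet E κ) :
    ∃ f, IsHierarchyOn E f (insertSet E κ κ) ∧ v = app E f κ := by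
  obtain ⟨f, s, hs, hf, hrec, hv⟩ := h
  obtain rfl := isSucc_iff.1 hs
  have htrans := isTransSet_insertSet_self hκ
  refine ⟨f, ⟨htrans, fun β hβ x => ?_⟩,
    (hf.opair_mem_iff (mem_insertSet.2 (Or.inr rfl)) v).1 (pairIn_iff.1 hv)⟩
  rw [hrec β _ (pairIn_iff.2 ((hf.opair_mem_iff hβ _).2 rfl))]
  refine exists_congr fun γ => ⟨?_, fun ⟨hγ, hx⟩ => ⟨_, hγ, pairIn_iff.2
    ((hf.opair_mem_iff (htrans β hβ γ hγ) _).2 rfl), hx⟩⟩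
  rintro ⟨z, hγ, hz, hx⟩
  obtain rfl := (hf.opair_mem_iff (htrans β hβ γ hγ) z).1 (pairIn_iff.1 hz)
  exact ⟨hγ, hx⟩

/-- Two hierarchies agree wherever both are defined, so the witness hidden in `MemVLevel` may be
replaced by any hierarchy at hand. -/
theorem level_eq {κ h s : V} (hκ : IsOrd E κ) (hh : IsHierarchyOn E h s) (hs : E κ s) :
    level E κ = app E h κ := by
  have key : ∀ x, E x (app E h κ) ↔ MemVLevel E κ x := by
    intro x
    constructor
    · intro hx
      exact ⟨_, hh.isVLevel hs hκ.1, hx⟩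
    · rintro ⟨v, hv, hx⟩
      obtain ⟨f, hf, rfl⟩ := hv.exists_hierarchy hκ.1
      rwa [hh.agree hf κ hs (mem_insertSet.2 (Or.inr rfl))]
  exact hE.extensional fun x => (mem_mkSet ⟨_, key⟩ x).trans (key x).symm

theorem exists_hierarchy_self {κ : V} (hκ : IsOrd E κ) :
    ∃ h s, IsHierarchyOn E h s ∧ E κ s ∧ ∀ γ, E γ κ → E γ s := by
  obtain ⟨h, hh⟩ := exists_isHierarchyOn (isTransSet_insertSet_self hκ.1)
  exact ⟨h, _, hh, mem_insertSet.2 (Or.inr rfl), fun γ hγ => mem_insertSet.2 (Or.inl hγ)⟩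

theorem mem_level_iff {κ x : V} (hκ : IsOrd E κ) : E x (level E κ) ↔ MemVLevel E κ x := by
  obtain ⟨h, s, hh, hs, -⟩ := exists_hierarchy_self hκ
  rw [level_eq hκ hh hs]
  constructor
  · intro hx
    exact ⟨_, hh.isVLevel hs hκ.1, hx⟩
  · rintro ⟨v, hv, hx⟩
    obtain ⟨f, hf, rfl⟩ := hv.exists_hierarchy hκ.1
    rwa [hh.agree hf κ hs (mem_insertSet.2 (Or.inr rfl))]

theorem mem_level {κ x : V} (hκ : IsOrd E κ) :
    E x (level E κ) ↔ ∃ γ, E γ κ ∧ IsSub E x (level E γ) := by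
  obtain ⟨h, s, hh, hs, hs'⟩ := exists_hierarchy_self hκ
  rw [level_eq hκ hh hs, hh.2 κ hs]
  refine exists_congr fun γ => and_congr_right fun hγ => ?_
  rw [level_eq (hκ.mem hγ) hh (hs' γ hγ)]

theorem level_mono {β γ : V} (hβ : IsOrd E β) (h : E γ β) : IsSub E (level E γ) (level E β) := by
  intro x hx
  obtain ⟨δ, hδ, hx⟩ := (mem_level (hβ.mem h)).1 hx
  exact (mem_level hβ).2 ⟨δ, hβ.trans h hδ, hx⟩

/-- Inductions and schemas are applied to `MemVLevel` rather than to `level`, since only the former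
is given a definability instance. -/
instance IsDef.memVLevel {ι : Type w} {M : ι → Type u} {E : ∀ i, M i → M i → Prop}
    {A : Set (∀ i, M i)} {n : ℕ} {a b : ∀ i, (Fin n → M i) → M i} [IsDefFun E A a]
    [IsDefFun E A b] : IsDef E A (fun i v => MemVLevel (E i) (a i v) (b i v)) :=
  IsDef.comp₂ (by unfold MemVLevel IsVLevel; infer_instance)

variable (E) in
theorem exists_mem_level (x : V) : ∃ α, IsOrd E α ∧ E x (level E α) := by
  suffices h : ∃ α, IsOrd E α ∧ MemVLevel E α x by
    obtain ⟨α, hα, h⟩ := h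
    exact ⟨α, hα, (mem_level_iff hα).2 h⟩
  refine SetModel.induction E (fun x => ∃ α, IsOrd E α ∧ MemVLevel E α x) (fun x ih => ?_) x
  obtain ⟨θ, hθ, h⟩ := exists_ord_bound (fun y α => MemVLevel E α y) x ih
  refine ⟨insertSet E θ θ, hθ.succ, (mem_level_iff hθ.succ).1 ((mem_level hθ.succ).2
    ⟨θ, mem_insertSet.2 (Or.inr rfl), fun y hy => ?_⟩)⟩
  obtain ⟨α, hα, hy⟩ := h y hy
  exact level_mono hθ hα y ((mem_level_iff (hθ.mem hα)).2 hy)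

theorem collection (R : V → V → Prop) [hR : IsClsRel E R] (a : V) :
    ∃ b, ∀ x, E x a → (∃ y, R x y) → ∃ y, E y b ∧ R x y := by
  have hR' := fun {n} => hR.comp (n := n)
  obtain ⟨θ, hθ, h⟩ := exists_ord_bound (fun x α => ∃ y, MemVLevel E α y ∧ R x y)
    (sep E a (fun x => ∃ y, R x y)) (by
      intro x hx
      obtain ⟨-, y, hy⟩ := mem_sep.1 hx
      obtain ⟨α, hα, hyα⟩ := exists_mem_level E y
      exact ⟨α, hα, y, (mem_level_iff hα).1 hyα, hy⟩)
  refine ⟨level E θ, fun x hx hy => ?_⟩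
  obtain ⟨α, hα, y, hyα, hy⟩ := h x (mem_sep.2 ⟨hx, hy⟩)
  exact ⟨y, level_mono hθ hα y ((mem_level_iff (hθ.mem hα)).2 hyα), hy⟩

/-- Collection bounds the candidates by a set `b`, so the choice axiom for sets can be applied to
the nonempty sets `{y ∈ b | R x y}`. -/
theorem exists_choice (R : V → V → Prop) [hR : IsClsRel E R] (a : V) :
    ∃ f, ∀ x, E x a → (∃ y, R x y) → R x (app E f x) := by
  have hR' := fun {n} => hR.comp (n := n)
  obtain ⟨b, hb⟩ := collection (E := E) R a
  obtain ⟨c, hc, hc'⟩ := hE.choice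
    (image E (sep E a (fun x => ∃ y, R x y)) (fun x => sep E b (fun y => R x y))) (by
      intro s hs
      obtain ⟨x, hx, rfl⟩ := mem_image.1 hs
      obtain ⟨hxa, hy⟩ := mem_sep.1 hx
      obtain ⟨y, hyb, hy⟩ := hb x hxa hy
      exact ⟨y, mem_sep.2 ⟨hyb, hy⟩⟩)
  refine ⟨graphOn E a (fun x => app E c (sep E b (fun y => R x y))), fun x hx hy => ?_⟩
  rw [app_graphOn hx]
  have hmem := (mem_image (F := fun x => sep E b (fun y => R x y))).2
    ⟨x, (mem_sep (P := fun x => ∃ y, R x y)).2 ⟨hx, hy⟩, rfl⟩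
  exact (mem_sep.1 (hc' _ _ (pairIn_iff.2 ((hc.opair_mem_iff hmem _).2 rfl)))).2

end Hierarchy

/-! ## Measures and the collapse of the ultrapower -/

section Definitions

variable {V : Type u} (E : V → V → Prop)

/-- `U` is a `κ`-complete nonprincipal ultrafilter on the uncountable cardinal `κ`. -/
structure IsMeasure (κ U : V) : Prop where
  card : IsUncountableCard E κ
  ultra : IsUltrafilterOn E U κ
  nonprincipal : IsNonprincipal E U
  complete : IsCompleteFor E U κ

/-- The predicate `P` holds on a set in `U`. -/
def AE (U : V) (P : V → Prop) : Prop := ∃ X, E X U ∧ ∀ α, E α X → P α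

variable [SetModel E]

/-- Membership in the ultrapower by `U`. -/
def LtU (U f g : V) : Prop := AE E U (fun α => E (app E f α) (app E g α))

/-- Equality in the ultrapower by `U`. -/
def EqU (U f g : V) : Prop := AE E U (fun α => app E f α = app E g α)

/-- The relations between `κ` and `x`, which represent the functions from `κ` to `x`. -/
noncomputable def funSpace (κ x : V) : V := pset E (prodSet E κ x)

/-- The part of the function `g` on `κ` that takes values in `x`. -/
noncomputable def restrictVal (κ g x : V) : V :=
  sep E (prodSet E κ x) (fun p => ∃ α, p = opair E α (app E g α))

/-- The set `c` is a collapsing map for the functions from `κ` to the transitive set `x`. -/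
def IsCollapseOn (κ U c x : V) : Prop :=
  IsTransSet E x ∧ ∀ g, E g (funSpace E κ x) → ∀ z, E z (app E c g) ↔
    ∃ h, E h (funSpace E κ x) ∧ LtU E U h g ∧ z = app E c h

/-- `z` is the image under the transitive collapse of the element of the ultrapower that is
represented by `f`. -/
def CollapsesTo (κ U f z : V) : Prop :=
  ∃ x c g, IsCollapseOn E κ U c x ∧ E g (funSpace E κ x) ∧ EqU E U g f ∧ z = app E c g

/-- The image of `f` in the transitive collapse of the ultrapower. -/
noncomputable def collapse (κ U f : V) : V :=
  @Classical.epsilon V (SetModel.nonempty E) (CollapsesTo E κ U f)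

end Definitions

section DefInstances

variable {ι : Type w} {M : ι → Type u} {E : ∀ i, M i → M i → Prop} {A : Set (∀ i, M i)} {n : ℕ}

theorem isMeasure_iff {V : Type u} {E : V → V → Prop} {κ U : V} : IsMeasure E κ U ↔
    IsUncountableCard E κ ∧ IsUltrafilterOn E U κ ∧ IsNonprincipal E U ∧ IsCompleteFor E U κ :=
  ⟨fun h => ⟨h.1, h.2, h.3, h.4⟩, fun h => ⟨h.1, h.2.1, h.2.2.1, h.2.2.2⟩⟩

theorem isMeasurableCard_iff {V : Type u} {E : V → V → Prop} {κ : V} :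
    IsMeasurableCard E κ ↔ ∃ U, IsMeasure E κ U := by
  simp only [isMeasure_iff, IsMeasurableCard, exists_and_left]

instance IsDef.isMeasure {a b : ∀ i, (Fin n → M i) → M i} [IsDefFun E A a] [IsDefFun E A b] :
    IsDef E A (fun i v => IsMeasure (E i) (a i v) (b i v)) :=
  IsDef.comp₂ (by simp only [isMeasure_iff]; infer_instance)

instance IsDef.ae {U : ∀ i, (Fin n → M i) → M i} {P : ∀ i, (Fin n → M i) → M i → Prop}
    [IsDefFun E A U] [h : IsDef E A (n := n + 1) (fun i w => P i (Fin.tail w) (w 0))] :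
    IsDef E A (fun i v => AE (E i) (U i v) (fun α => P i v α)) := by
  have : IsDef E A (n := n + 2) (fun i w => P i (Fin.tail (Fin.tail w)) (w 0)) :=
    h.comp_sel (fun i w => w ∘ (Fin.cases 0 (fun k => k.succ.succ) : Fin (n + 1) → _))
      (hs := ⟨⟨_, fun _ _ => rfl⟩⟩)
  unfold AE
  infer_instance

variable [hE : ∀ i, SetModel (E i)]

instance IsDef.ltU {a b c : ∀ i, (Fin n → M i) → M i} [IsDefFun E A a] [IsDefFun E A b]
    [IsDefFun E A c] : IsDef E A (fun i v => LtU (E i) (a i v) (b i v) (c i v)) := by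
  unfold LtU
  infer_instance

instance IsDef.eqU {a b c : ∀ i, (Fin n → M i) → M i} [IsDefFun E A a] [IsDefFun E A b]
    [IsDefFun E A c] : IsDef E A (fun i v => EqU (E i) (a i v) (b i v) (c i v)) := by
  unfold EqU
  infer_instance

instance IsDefFun.funSpace {a b : ∀ i, (Fin n → M i) → M i} [IsDefFun E A a] [IsDefFun E A b] :
    IsDefFun E A (fun i v => funSpace (E i) (a i v) (b i v)) := by
  unfold InnerModelReflect.funSpace
  infer_instance

instance IsDef.isCollapseOn {a b c d : ∀ i, (Fin n → M i) → M i} [IsDefFun E A a] [IsDefFun E A b]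
    [IsDefFun E A c] [IsDefFun E A d] :
    IsDef E A (fun i v => IsCollapseOn (E i) (a i v) (b i v) (c i v) (d i v)) := by
  unfold IsCollapseOn
  infer_instance

instance IsDef.collapsesTo {a b c d : ∀ i, (Fin n → M i) → M i} [IsDefFun E A a] [IsDefFun E A b]
    [IsDefFun E A c] [IsDefFun E A d] :
    IsDef E A (fun i v => CollapsesTo (E i) (a i v) (b i v) (c i v) (d i v)) := by
  unfold CollapsesTo
  infer_instance

end DefInstances

section Measure

variable {V : Type u} {E : V → V → Prop} [hE : SetModel E] {κ U : V}

omit hE in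
theorem AE.mono {P Q : V → Prop} (h : AE E U P) (hPQ : ∀ α, P α → Q α) : AE E U Q :=
  let ⟨X, hX, hP⟩ := h
  ⟨X, hX, fun α hα => hPQ α (hP α hα)⟩

namespace IsMeasure

variable (hU : IsMeasure E κ U)

include hU

omit hE in
theorem isOrd : IsOrd E κ := hU.card.1.1

/-- `AE` makes sense for arbitrary predicates. Definability matters only here, where the set of all
good indices has to exist. -/
theorem ae_iff {P : V → Prop} [IsCls E P] : AE E U P ↔ E (sep E κ P) U := by
  constructor
  · rintro ⟨X, hX, hP⟩
    exact hU.ultra.up X _ hX (fun z hz => mem_sep.2 ⟨hU.ultra.sub X hX z hz, hP z hz⟩)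
      (fun z hz => (mem_sep.1 hz).1)
  · exact fun h => ⟨_, h, fun α hα => (mem_sep.1 hα).2⟩

omit hE in
theorem ae_of_forall {P : V → Prop} (h : ∀ α, E α κ → P α) : AE E U P := ⟨κ, hU.ultra.top, h⟩

theorem ae_and {P Q : V → Prop} (hP : AE E U P) (hQ : AE E U Q) : AE E U (fun α => P α ∧ Q α) := by
  obtain ⟨X, hX, hP⟩ := hP
  obtain ⟨Y, hY, hQ⟩ := hQ
  refine ⟨sep E X (fun z => E z Y), hU.ultra.inter X Y _ hX hY fun z => mem_sep, fun α hα => ?_⟩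
  exact ⟨hP α (mem_sep.1 hα).1, hQ α (mem_sep.1 hα).2⟩

theorem ae_exists {P : V → Prop} (h : AE E U P) : ∃ α, E α κ ∧ P α := by
  obtain ⟨X, hX, hP⟩ := h
  by_contra hne
  push Not at hne
  have hXe : X = emptySet E := hE.extensional fun z =>
    ⟨fun hz => absurd (hP z hz) (hne z (hU.ultra.sub X hX z hz)), fun hz => absurd hz mem_emptySet⟩
  exact (hU.ultra.ultra κ (emptySet E) (fun _ h => h)
    (fun z => ⟨fun h => absurd h mem_emptySet, fun h => absurd h.1 h.2⟩)).1 hU.ultra.top (hXe ▸ hX)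

theorem not_ae {P : V → Prop} [hP : IsCls E P] : ¬ AE E U P ↔ AE E U (fun α => ¬ P α) := by
  rw [hU.ae_iff, hU.ae_iff]
  have := hU.ultra.ultra (sep E κ (fun α => ¬ P α)) (sep E κ P) (fun z hz => (mem_sep.1 hz).1)
    (fun z => by simp only [mem_sep]; tauto)
  exact this.symm

theorem ae_forall_lt {δ : V} (hδ : E δ κ) (P : V → V → Prop) [hP : IsClsRel E P]
    (h : ∀ β, E β δ → AE E U (P β)) : AE E U (fun α => ∀ β, E β δ → P β α) := by
  have hP' := fun {n} => hP.comp (n := n)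
  have hs : ∀ β X, PairIn E (graphOn E δ (fun β => sep E κ (fun α => P β α))) β X ↔
      E β δ ∧ X = sep E κ (fun α => P β α) := by
    intro β X
    rw [pairIn_iff (E := E)]
    refine mem_graphOn.trans ⟨?_, ?_⟩
    · rintro ⟨x', hx', h⟩
      obtain ⟨rfl, rfl⟩ := opair_inj.1 h
      exact ⟨hx', rfl⟩
    · rintro ⟨hx, rfl⟩
      exact ⟨β, hx, rfl⟩
  refine hU.ae_iff.2 (hU.complete δ hδ _
    (isFunOn_graphOn (F := fun β => sep E κ (fun α => P β α))) ?_ _ ?_)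
  · intro β X hX
    obtain ⟨hβ, rfl⟩ := (hs β X).1 hX
    exact hU.ae_iff.1 (h β hβ)
  · intro z
    rw [mem_sep (E := E)]
    refine and_congr_right fun hz => ⟨?_, ?_⟩
    · intro h β X hX
      obtain ⟨hβ, rfl⟩ := (hs β X).1 hX
      exact mem_sep.2 ⟨hz, h β hβ⟩
    · intro h β hβ
      exact (mem_sep.1 (h β _ ((hs β _).2 ⟨hβ, rfl⟩))).2

/-- Completeness in dual form: when fewer than `κ` pieces cover a set in `U`, one of the pieces has
measure one. -/
theorem exists_lt_ae {δ : V} (hδ : E δ κ) (P : V → V → Prop) [hP : IsClsRel E P]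
    (h : AE E U (fun α => ∃ β, E β δ ∧ P β α)) : ∃ β, E β δ ∧ AE E U (P β) := by
  have hP' := fun {n} => hP.comp (n := n)
  by_contra hne
  push Not at hne
  have := hU.ae_forall_lt hδ (fun β α => ¬ P β α) fun β hβ => hU.not_ae.1 (hne β hβ)
  obtain ⟨α, -, ⟨β, hβ, h⟩, h'⟩ := hU.ae_exists (hU.ae_and h this)
  exact h' β hβ h

theorem ae_ne (x : V) : AE E U (fun α => α ≠ x) := by
  refine hU.not_ae.1 ?_
  rintro ⟨X, hX, h⟩
  refine hU.nonprincipal X x (fun z => ⟨fun hz => Or.inl (h z hz), ?_⟩) hX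
  obtain ⟨α, -, hα⟩ := hU.ae_exists ⟨X, hX, fun α hα => hα⟩
  rintro (rfl | rfl) <;> exact h α hα ▸ hα

theorem eqU_refl (f : V) : EqU E U f f := hU.ae_of_forall fun _ _ => rfl

theorem eqU_trans {f g h : V} (h₁ : EqU E U f g) (h₂ : EqU E U g h) : EqU E U f h :=
  (hU.ae_and h₁ h₂).mono fun _ h => h.1.trans h.2

theorem ltU_congr {f f' g g' : V} (h : LtU E U f g) (hf : EqU E U f f') (hg : EqU E U g g') :
    LtU E U f' g' :=
  (hU.ae_and (hU.ae_and h hf) hg).mono fun α h => by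
    have := h.1.1
    rwa [h.1.2, h.2] at this

end IsMeasure

theorem EqU.symm {f g : V} (h : EqU E U f g) : EqU E U g f := AE.mono h fun _ h => h.symm

theorem insertSet_self_inj {x y : V} (h : insertSet E x x = insertSet E y y) : x = y := by
  have hx : E x y ∨ x = y := mem_insertSet.1 (h ▸ (mem_insertSet (E := E)).2 (Or.inr rfl))
  have hy : E y x ∨ y = x := mem_insertSet.1 (h.symm ▸ (mem_insertSet (E := E)).2 (Or.inr rfl))
  rcases hx with hx | hx
  · rcases hy with hy | hy
    · exact absurd hy (mem_asymm hx)
    · exact hy.symm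
  · exact hx

/-- Otherwise choice and recursion give a descending sequence indexed by some `w ∈ κ` closed under
successor. Fewer than `κ` sets of measure one have a common index `α`, and the values at `α` then
contradict foundation. -/
theorem IsMeasure.wellFounded (hU : IsMeasure E κ U) (d : V) (hd : ∃ f, E f d) :
    ∃ f, E f d ∧ ∀ g, E g d → ¬ LtU E U g f := by
  by_contra hne
  push Not at hne
  obtain ⟨w, hw, hw0, hws⟩ := hU.card.2
  have hws : ∀ x, E x w → E (insertSet E x x) w := fun x hx => by
    obtain ⟨s, hs, hsw⟩ := hws x hx
    rwa [isSucc_iff.1 hs] at hsw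
  -- On a singleton `{f}` the function `s` picks something below `f`. On other subsets, such as the
  -- empty set met at points of `w` that are not successors, any element of `d` will do.
  obtain ⟨s, hs⟩ := exists_choice (E := E) (fun z g => E g d ∧ ∀ f, z = upair E f f → LtU E U g f) (pset E d)
  have hs : ∀ z, IsSub E z d → E (app E s z) d ∧ ∀ f, z = upair E f f → LtU E U (app E s z) f := by
    intro z hz
    refine hs z (mem_pset.2 hz) ?_
    by_cases hzf : ∃ f, z = upair E f f
    · obtain ⟨f, rfl⟩ := hzf
      obtain ⟨g, hg, hgf⟩ := hne f (hz f (mem_upair.2 (Or.inl rfl)))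
      refine ⟨g, hg, fun f' hf' => ?_⟩
      rcases upair_inj hf' with h | h <;> rwa [← h.1]
    · obtain ⟨f, hf⟩ := hd
      exact ⟨f, hf, fun f hf => absurd ⟨f, hf⟩ hzf⟩
  -- Recursion along the immediate-successor relation: at `m ∪ {m}` the set of earlier values is
  -- exactly `{c(m)}`.
  obtain ⟨c, hc⟩ := exists_recursion w (fun m n => IsSucc E n m) (fun z => app E s z) (by
    intro e _ he
    obtain ⟨x, hx, hmin⟩ := hE.foundation e he
    refine ⟨x, hx, fun y hy hyx => hmin y ?_ hy⟩
    exact (hyx y).2 (Or.inr rfl))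
  have hcd : ∀ n, E n w → E (app E c n) d := by
    refine SetModel.induction E (fun n => E n w → E (app E c n) d) fun n ih hn => ?_
    rw [hc n hn]
    refine (hs _ fun y hy => ?_).1
    obtain ⟨m, hm, rfl⟩ := mem_image.1 hy
    obtain ⟨hmw, hmn⟩ := mem_sep.1 hm
    exact ih m ((hmn m).2 (Or.inr rfl)) hmw
  have hlt : ∀ m, E m w → LtU E U (app E c (insertSet E m m)) (app E c m) := by
    intro m hm
    rw [hc _ (hws m hm)]
    have : image E (sep E w (fun y => IsSucc E (insertSet E m m) y)) (fun y => app E c y) =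
        upair E (app E c m) (app E c m) := by
      refine hE.extensional fun z => ?_
      rw [mem_image (E := E), mem_upair (E := E), or_self]
      constructor
      · rintro ⟨y, hy, rfl⟩
        rw [insertSet_self_inj (isSucc_iff.1 (mem_sep.1 hy).2)]
      · rintro rfl
        exact ⟨m, mem_sep.2 ⟨hm, isSucc_iff.2 rfl⟩, rfl⟩
    rw [this]
    refine (hs _ fun y hy => ?_).2 _ rfl
    rcases mem_upair.1 hy with rfl | rfl <;> exact hcd m hm
  have hP : IsClsRel E (fun m α =>
    E (app E (app E c (insertSet E m m)) α) (app E (app E c m) α)) := inferInstance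
  obtain ⟨α, -, hα⟩ := hU.ae_exists (hU.ae_forall_lt hw (fun m α =>
    E (app E (app E c (insertSet E m m)) α) (app E (app E c m) α)) hlt)
  obtain ⟨m₀, hm₀⟩ := hw0
  obtain ⟨x, hx, hmin⟩ := hE.foundation (image E w (fun m => app E (app E c m) α))
    ⟨_, mem_image.2 ⟨m₀, hm₀, rfl⟩⟩
  obtain ⟨m, hm, rfl⟩ := mem_image.1 hx
  exact hmin _ (hα m hm) (mem_image.2 ⟨_, hws m hm, rfl⟩)

end Measure

section Collapse

variable {V : Type u} {E : V → V → Prop} [hE : SetModel E] {κ U : V}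

theorem restrictVal_mem (g x : V) : E (restrictVal E κ g x) (funSpace E κ x) :=
  mem_pset.2 fun _ hz => (mem_sep.1 hz).1

theorem app_restrictVal {g x α : V} (hα : E α κ) (h : E (app E g α) x) :
    app E (restrictVal E κ g x) α = app E g α :=
  app_eq fun z => by
    refine mem_sep.trans ⟨?_, ?_⟩
    · rintro ⟨-, β, hβ⟩
      obtain ⟨rfl, rfl⟩ := opair_inj.1 hβ
      rfl
    · rintro rfl
      exact ⟨mem_prodSet.2 ⟨α, hα, _, h, rfl⟩, α, rfl⟩

theorem mem_of_mem_app {f x α z : V} (hx : IsTransSet E x) (hf : E f (funSpace E κ x))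
    (hz : E z (app E f α)) : E z x := by
  obtain ⟨y, hy, hz⟩ := mem_app.1 hz
  obtain ⟨α', -, y', hy', h⟩ := mem_prodSet.1 (mem_pset.1 hf _ hy)
  obtain ⟨rfl, rfl⟩ := opair_inj.1 h
  exact hx y hy' z hz

namespace IsMeasure

variable (hU : IsMeasure E κ U)

include hU

theorem eqU_restrictVal {f x : V} (h : AE E U (fun α => E (app E f α) x)) :
    EqU E U (restrictVal E κ f x) f :=
  (hU.ae_and h (hU.ae_of_forall fun _ h => h)).mono fun _ hα => app_restrictVal hα.2 hα.1

/-- As `x` is transitive, `h(α) ∈ f(α)` forces `h(α) ∈ x`. Hence everything below `f` in the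
class-sized ultrapower already has a representative in the set `funSpace E κ x`. -/
theorem eqU_restrictVal_of_ltU {f h x : V} (hx : IsTransSet E x) (hf : E f (funSpace E κ x))
    (hlt : LtU E U h f) : EqU E U (restrictVal E κ h x) h :=
  hU.eqU_restrictVal (hlt.mono fun _ hα => mem_of_mem_app hx hf hα)

theorem exists_isCollapseOn {x : V} (hx : IsTransSet E x) : ∃ c, IsCollapseOn E κ U c x := by
  obtain ⟨c, hc⟩ := exists_recursion (E := E) (funSpace E κ x) (fun f g => LtU E U f g) (fun z => z)
    fun e _ he => hU.wellFounded e he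
  refine ⟨c, hx, fun g hg z => ?_⟩
  rw [hc g hg]
  refine mem_image.trans (exists_congr fun h => ?_)
  rw [mem_sep (E := E), and_assoc]

/-- At a minimal disagreement, each function below one representative can be cut down to one below
the other, where the two collapses agree. -/
theorem collapse_agree {c x c' x' : V} (hc : IsCollapseOn E κ U c x) (hc' : IsCollapseOn E κ U c' x')
    {g g' : V} (hg : E g (funSpace E κ x)) (hg' : E g' (funSpace E κ x')) (hgg' : EqU E U g g') :
    app E c g = app E c' g' := by
  by_contra hne
  obtain ⟨f, hf, hmin⟩ := hU.wellFounded (sep E (funSpace E κ x)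
    (fun g => ∃ g', E g' (funSpace E κ x') ∧ EqU E U g g' ∧ app E c g ≠ app E c' g'))
    ⟨g, mem_sep.2 ⟨hg, g', hg', hgg', hne⟩⟩
  obtain ⟨hfx, f', hfx', hff', hne⟩ := mem_sep.1 hf
  have ih : ∀ h h', E h (funSpace E κ x) → E h' (funSpace E κ x') → LtU E U h f → EqU E U h h' →
      app E c h = app E c' h' := by
    intro h h' hh hh' hlt heq
    by_contra hne
    exact hmin h (mem_sep.2 ⟨hh, h', hh', heq, hne⟩) hlt
  refine hne (hE.extensional fun z => ?_)
  rw [hc.2 f hfx, hc'.2 f' hfx']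
  constructor
  · rintro ⟨h, hh, hlt, rfl⟩
    have hlt' := hU.ltU_congr hlt (hU.eqU_refl h) hff'
    have heq := hU.eqU_restrictVal_of_ltU hc'.1 hfx' hlt'
    exact ⟨_, restrictVal_mem h x', hU.ltU_congr hlt' heq.symm (hU.eqU_refl f'),
      ih h _ hh (restrictVal_mem h x') hlt heq.symm⟩
  · rintro ⟨h, hh, hlt, rfl⟩
    have hlt' := hU.ltU_congr hlt (hU.eqU_refl h) hff'.symm
    have heq := hU.eqU_restrictVal_of_ltU hc.1 hfx hlt'
    have hlt'' := hU.ltU_congr hlt' heq.symm (hU.eqU_refl f)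
    exact ⟨_, restrictVal_mem h x, hlt'', (ih _ h (restrictVal_mem h x) hh hlt'' heq).symm⟩

omit hU in
variable (κ) in
theorem exists_transitive_range (f : V) :
    ∃ x, IsTransSet E x ∧ ∀ α, E α κ → E (app E f α) x := by
  obtain ⟨x, hx, hsub, -⟩ := exists_transitive_closure (E := E) (image E κ (fun α => app E f α))
  exact ⟨x, hx, fun α hα => hsub _ (mem_image.2 ⟨α, hα, rfl⟩)⟩

theorem exists_collapsesTo (f : V) : ∃ z, CollapsesTo E κ U f z := by
  obtain ⟨x, hx, hmem⟩ := exists_transitive_range (E := E) κ f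
  obtain ⟨c, hc⟩ := hU.exists_isCollapseOn hx
  exact ⟨_, x, c, restrictVal E κ f x, hc, restrictVal_mem f x,
    hU.eqU_restrictVal (hU.ae_of_forall hmem), rfl⟩

theorem collapsesTo_unique {f z z' : V} (h : CollapsesTo E κ U f z) (h' : CollapsesTo E κ U f z') :
    z = z' := by
  obtain ⟨x, c, g, hc, hg, heq, rfl⟩ := h
  obtain ⟨x', c', g', hc', hg', heq', rfl⟩ := h'
  exact hU.collapse_agree hc hc' hg hg' (hU.eqU_trans heq heq'.symm)

/-- `CollapsesTo` is total and single-valued, so the choice operator in `collapse` is harmless and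
`collapse` inherits its definability. -/
theorem eq_collapse_iff {f z : V} : z = collapse E κ U f ↔ CollapsesTo E κ U f z := by
  have h : CollapsesTo E κ U f (collapse E κ U f) :=
    Classical.epsilon_spec (p := CollapsesTo E κ U f) (hU.exists_collapsesTo f)
  exact ⟨fun hz => hz ▸ h, fun hz => hU.collapsesTo_unique hz h⟩

theorem isClsFun_collapse : IsClsFun E (fun f => collapse E κ U f) :=
  have h : IsDef (ι := Unit) (M := fun _ => V) (fun _ => E) Set.univ
    (fun _ (w : Fin 2 → V) => CollapsesTo E κ U (w 1) (w 0)) := inferInstance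
  ⟨h.congr fun _ _ => hU.eq_collapse_iff⟩

theorem mem_collapse {f z : V} :
    E z (collapse E κ U f) ↔ ∃ h, LtU E U h f ∧ z = collapse E κ U h := by
  obtain ⟨x, c, g, hc, hg, heq, hcol⟩ := hU.eq_collapse_iff.1 (rfl : collapse E κ U f = _)
  rw [hcol, hc.2 g hg]
  constructor
  · rintro ⟨h, hh, hlt, rfl⟩
    exact ⟨h, hU.ltU_congr hlt (hU.eqU_refl h) heq,
      hU.eq_collapse_iff.2 ⟨x, c, h, hc, hh, hU.eqU_refl h, rfl⟩⟩
  · rintro ⟨h, hlt, rfl⟩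
    have hlt' := hU.ltU_congr hlt (hU.eqU_refl h) heq.symm
    have heq' := hU.eqU_restrictVal_of_ltU hc.1 hg hlt'
    refine ⟨_, restrictVal_mem h x, hU.ltU_congr hlt' heq'.symm (hU.eqU_refl g), ?_⟩
    exact (hU.eq_collapse_iff.2 ⟨x, c, _, hc, restrictVal_mem h x, heq', rfl⟩).symm

theorem collapse_congr {f g : V} (h : EqU E U f g) : collapse E κ U f = collapse E κ U g := by
  refine hE.extensional fun z => ?_
  rw [hU.mem_collapse, hU.mem_collapse]
  exact exists_congr fun k => and_congr_left fun _ =>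
    ⟨fun hk => hU.ltU_congr hk (hU.eqU_refl k) h, fun hk => hU.ltU_congr hk (hU.eqU_refl k) h.symm⟩

/-- Extensionality of the ultrapower: choose `k(α)` in the symmetric difference of `f(α)` and
`g(α)`, and let the ultrafilter decide on which side it falls. -/
theorem exists_ltU_of_not_eqU {f g : V} (h : ¬ EqU E U f g) :
    ∃ k, (LtU E U k f ∧ ¬ LtU E U k g) ∨ (LtU E U k g ∧ ¬ LtU E U k f) := by
  have h := hU.not_ae.1 h
  obtain ⟨k, hk⟩ := exists_choice (E := E) (fun α z => ¬ (E z (app E f α) ↔ E z (app E g α))) κ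
  have hk : AE E U (fun α => ¬ (E (app E k α) (app E f α) ↔ E (app E k α) (app E g α))) :=
    (hU.ae_and h (hU.ae_of_forall fun _ h => h)).mono fun α hα => hk α hα.2 (by
      by_contra hne
      push Not at hne
      exact hα.1 (hE.extensional hne))
  refine ⟨k, ?_⟩
  by_contra hne
  by_cases hf : LtU E U k f
  · have hg : LtU E U k g := by tauto
    obtain ⟨α, -, h⟩ := hU.ae_exists (hU.ae_and hk (hU.ae_and hf hg))
    exact h.1 ⟨fun _ => h.2.2, fun _ => h.2.1⟩
  · have hg : ¬ LtU E U k g := by tauto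
    obtain ⟨α, -, h⟩ := hU.ae_exists (hU.ae_and hk (hU.ae_and (hU.not_ae.1 hf) (hU.not_ae.1 hg)))
    exact h.1 ⟨fun h' => absurd h' h.2.1, fun h' => absurd h' h.2.2⟩

/-- Induction on the common value `z`: if `k` is below `f`, its collapse lies in `z` and so is the
collapse of some `k'` below `g`. By induction `k` and `k'` are equivalent, so `f` and `g` have the
same predecessors and extensionality applies. -/
theorem collapse_eq_iff {f g : V} : collapse E κ U f = collapse E κ U g ↔ EqU E U f g := by
  refine ⟨fun h => ?_, hU.collapse_congr⟩
  have hcol := fun {n} => hU.isClsFun_collapse.comp (n := n)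
  refine SetModel.induction E (fun z => ∀ f g, z = collapse E κ U f → z = collapse E κ U g →
    EqU E U f g) ?_ _ f g rfl h
  intro z ih f g hf hg
  have key : ∀ f g, z = collapse E κ U f → z = collapse E κ U g → ∀ k, LtU E U k f → LtU E U k g := by
    intro f g hf hg k hk
    have hkz : E (collapse E κ U k) z := hf ▸ hU.mem_collapse.2 ⟨k, hk, rfl⟩
    obtain ⟨k', hk', heq⟩ := hU.mem_collapse.1 (hg ▸ hkz)
    exact hU.ltU_congr hk' (ih _ hkz k' k heq rfl) (hU.eqU_refl g)
  by_contra hne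
  obtain ⟨k, hk | hk⟩ := hU.exists_ltU_of_not_eqU hne
  · exact hk.2 (key f g hf hg k hk.1)
  · exact hk.2 (key g f hg hf k hk.1)

theorem collapse_mem_iff {f g : V} : E (collapse E κ U f) (collapse E κ U g) ↔ LtU E U f g := by
  rw [hU.mem_collapse]
  constructor
  · rintro ⟨h, hlt, heq⟩
    exact hU.ltU_congr hlt (hU.collapse_eq_iff.1 heq.symm) (hU.eqU_refl g)
  · exact fun h => ⟨f, h, rfl⟩

end IsMeasure

end Collapse

/-! ## The ultrapower as an inner model -/

section Los

variable {V : Type u} (E : V → V → Prop) [hE : SetModel E]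

/-- The transitive collapse of the ultrapower of the universe by `U`. -/
def ultrapower (κ U : V) : Set V := Set.range (collapse E κ U)

/-- The element of the collapsed ultrapower that is represented by `f`. -/
noncomputable def toUltrapower (κ U f : V) : ultrapower E κ U := ⟨collapse E κ U f, f, rfl⟩

/-- The constant function on `κ` with value `a`. -/
noncomputable def constFun (κ a : V) : V := graphOn E κ (fun _ => a)

/-- The ultrapower embedding. -/
noncomputable def ultraEmbedding (κ U a : V) : V := collapse E κ U (constFun E κ a)

instance IsDefFun.constFun {ι : Type w} {M : ι → Type u} {E : ∀ i, M i → M i → Prop}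
    {A : Set (∀ i, M i)} {n : ℕ} [∀ i, SetModel (E i)] {a b : ∀ i, (Fin n → M i) → M i}
    [IsDefFun E A a] [IsDefFun E A b] : IsDefFun E A (fun i v => constFun (E i) (a i v) (b i v)) := by
  unfold InnerModelReflect.constFun
  infer_instance

variable {E} {κ U : V}

theorem app_constFun {α a : V} (hα : E α κ) : app E (constFun E κ a) α = a := by
  exact app_graphOn (F := fun _ => a) hα

namespace IsMeasure

variable (hU : IsMeasure E κ U)

include hU

/-- Łoś's theorem. The atomic cases are injectivity and `∈`-preservation of the collapse,
implication uses that `U` is ultra, and the quantifier uses choice. -/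
theorem realize_ultrapower {α : Type} {k : ℕ} (φ : setLang.BoundedFormula α k) (v : α → V)
    (xs : Fin k → V) :
    @BoundedFormula.Realize setLang (ultrapower E κ U)
      (memStructure (restrictMem E (ultrapower E κ U))) α k φ
      (fun j => toUltrapower E κ U (v j)) (fun j => toUltrapower E κ U (xs j)) ↔
    AE E U (fun β => @BoundedFormula.Realize setLang V (memStructure E) α k φ
      (fun j => app E (v j) β) (fun j => app E (xs j) β)) := by
  induction φ with
  | falsum => exact ⟨False.elim, fun h => (hU.ae_exists h).choose_spec.2.elim⟩
  | @equal k r₁ r₂ =>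
    have key : ∀ x y : V, toUltrapower E κ U x = toUltrapower E κ U y ↔
        AE E U (fun β => app E x β = app E y β) := fun x y =>
      Subtype.ext_iff.trans hU.collapse_eq_iff
    rcases r₁ with (i | i) | f
    rotate_left 2
    · exact Empty.elim f
    all_goals
      rcases r₂ with (j | j) | f
      rotate_left 2
      · exact Empty.elim f
      all_goals exact key _ _
  | @rel k l R r =>
    have key : ∀ x y : V, restrictMem E (ultrapower E κ U) (toUltrapower E κ U x)
        (toUltrapower E κ U y) ↔ AE E U (fun β => E (app E x β) (app E y β)) := fun x y =>
      hU.collapse_mem_iff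
    cases R with
    | mem =>
      change restrictMem E (ultrapower E κ U) (@Term.realize setLang _ (memStructure _) _ _ (r 0))
        (@Term.realize setLang _ (memStructure _) _ _ (r 1)) ↔ AE E U (fun β =>
          E (@Term.realize setLang _ (memStructure _) _ _ (r 0))
            (@Term.realize setLang _ (memStructure _) _ _ (r 1)))
      generalize r 0 = r₁
      generalize r 1 = r₂
      rcases r₁ with (i | i) | f
      rotate_left 2
      · exact Empty.elim f
      all_goals
        rcases r₂ with (j | j) | f
        rotate_left 2
        · exact Empty.elim f
        all_goals exact key _ _
  | @imp k φ ψ ih₁ ih₂ =>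
    have h₁ : IsCls E (fun β => @BoundedFormula.Realize setLang V (memStructure E) α k φ
      (fun j => app E (v j) β) (fun j => app E (xs j) β)) :=
      IsDef.realize (ι := Unit) (M := fun _ => V) (E := fun _ => E) φ
        (fun j _ u => app E (v j) (u 0)) (fun j _ u => app E (xs j) (u 0))
        (fun j => inferInstance) (fun j => inferInstance)
    refine (imp_congr (ih₁ xs) (ih₂ xs)).trans ⟨fun h => ?_, fun h h' => ?_⟩
    · by_cases hφ : AE E U (fun β => @BoundedFormula.Realize setLang V (memStructure E) α k φ
        (fun j => app E (v j) β) (fun j => app E (xs j) β))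
      · exact (h hφ).mono fun _ hψ _ => hψ
      · exact (hU.not_ae.1 hφ).mono fun _ h h' => absurd h' h
    · exact (hU.ae_and h h').mono fun _ h => h.1 h.2
  | @all k φ ih =>
    have hsnoc : ∀ f β, (fun j => app E (Fin.snoc (α := fun _ => V) xs f j) β) =
        (Fin.snoc (α := fun _ => V) (fun j => app E (xs j) β) (app E f β) : Fin (k + 1) → V) := by
      intro f β
      funext j
      refine Fin.lastCases ?_ (fun j => ?_) j <;> simp
    have hsnoc' : ∀ f, (fun j => toUltrapower E κ U (Fin.snoc (α := fun _ => V) xs f j)) =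
        (Fin.snoc (α := fun _ => ultrapower E κ U) (fun j => toUltrapower E κ U (xs j))
          (toUltrapower E κ U f) : Fin (k + 1) → ultrapower E κ U) := by
      intro f
      funext j
      refine Fin.lastCases ?_ (fun j => ?_) j <;> simp
    have ih' : ∀ f, @BoundedFormula.Realize setLang (ultrapower E κ U)
        (memStructure (restrictMem E (ultrapower E κ U))) α (k + 1) φ
        (fun j => toUltrapower E κ U (v j))
        (Fin.snoc (fun j => toUltrapower E κ U (xs j)) (toUltrapower E κ U f)) ↔
      AE E U (fun β => @BoundedFormula.Realize setLang V (memStructure E) α (k + 1) φ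
        (fun j => app E (v j) β) (Fin.snoc (fun j => app E (xs j) β) (app E f β))) := by
      intro f
      rw [← hsnoc', ih]
      simp only [hsnoc]
    change (∀ x, _) ↔ AE E U (fun β => ∀ y, _)
    constructor
    · intro h
      have hR : IsClsRel E (fun β y => ¬ @BoundedFormula.Realize setLang V (memStructure E) α (k + 1)
          φ (fun j => app E (v j) β) (Fin.snoc (fun j => app E (xs j) β) y)) := by
        have := IsDef.realize (ι := Unit) (M := fun _ => V) (E := fun _ => E) (A := Set.univ)
          (n := 2) φ (fun j _ u => app E (v j) (u 0))
          (Fin.snoc (α := fun _ => Unit → (Fin 2 → V) → V) (fun j _ u => app E (xs j) (u 0))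
            (fun _ u => u 1)) (fun j => inferInstance) (by
            refine Fin.lastCases ?_ fun j => ?_
            · simp only [Fin.snoc_last]; infer_instance
            · simp only [Fin.snoc_castSucc]; infer_instance)
        refine (IsDef.not (hP := this)).congr fun _ u => not_congr (iff_of_eq (congr_arg _ ?_))
        funext j
        refine Fin.lastCases ?_ (fun j => ?_) j <;> simp
      have hcl : IsCls E (fun β => ∃ y, ¬ @BoundedFormula.Realize setLang V (memStructure E) α
          (k + 1) φ (fun j => app E (v j) β) (Fin.snoc (fun j => app E (xs j) β) y)) := by
        have := hR.comp_sel (fun _ (w : Fin 2 → V) => w ∘ ![1, 0]) (hs := ⟨⟨_, fun _ _ => rfl⟩⟩)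
        exact IsDef.ex (hP := this)
      by_contra hne
      have hne : AE E U (fun β => ∃ y, ¬ @BoundedFormula.Realize setLang V (memStructure E) α (k + 1)
          φ (fun j => app E (v j) β) (Fin.snoc (fun j => app E (xs j) β) y)) := by
        by_contra hne'
        refine hne ((hU.not_ae.1 hne').mono fun β hβ => ?_)
        push Not at hβ
        exact hβ
      -- If almost every `β` has a counterexample, a set function `f` selects them, and the element
      -- of the ultrapower represented by `f` refutes `h`.
      obtain ⟨f, hf⟩ := exists_choice (E := E) (fun β y => ¬ @BoundedFormula.Realize setLang V
        (memStructure E) α (k + 1) φ (fun j => app E (v j) β)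
        (Fin.snoc (fun j => app E (xs j) β) y)) κ
      obtain ⟨β, hβ, h1, h2⟩ := hU.ae_exists (hU.ae_and hne ((ih' f).1 (h _)))
      exact hf β hβ h1 h2
    · rintro h ⟨_, f, rfl⟩
      exact (ih' f).2 (h.mono fun β hβ => hβ _)

theorem sat_ultrapower {α : Type} (φ : setLang.Formula α) (v : α → V) :
    Sat (restrictMem E (ultrapower E κ U)) φ (fun j => toUltrapower E κ U (v j)) ↔
      AE E U (fun β => Sat E φ (fun j => app E (v j) β)) := by
  have := hU.realize_ultrapower φ v Fin.elim0
  rw [Subsingleton.elim (fun j => toUltrapower E κ U (Fin.elim0 j)) default] at this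
  refine this.trans (iff_of_eq (congr_arg (AE E U) (funext fun β => ?_)))
  exact congr_arg (@BoundedFormula.Realize setLang V (memStructure E) α 0 φ _)
    (Subsingleton.elim _ _)

theorem ae_const {P : Prop} : AE E U (fun _ => P) ↔ P :=
  ⟨fun h => (hU.ae_exists h).choose_spec.2, fun h => hU.ae_of_forall fun _ _ => h⟩

theorem sat_ultrapower_const {α : Type} (φ : setLang.Formula α) (a : α → V) :
    Sat (restrictMem E (ultrapower E κ U)) φ (fun j => toUltrapower E κ U (constFun E κ (a j))) ↔
      Sat E φ a := by
  rw [hU.sat_ultrapower, ← hU.ae_const (P := Sat E φ a)]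
  have : ∀ β, E β κ → (fun j => app E (constFun E κ (a j)) β) = a := fun β hβ =>
    funext fun j => app_constFun hβ
  constructor <;> refine fun h => (hU.ae_and h (hU.ae_of_forall fun _ h => h)).mono fun β hβ => ?_
  · have h := hβ.1
    rwa [this β hβ.2] at h
  · rw [this β hβ.2]
    exact hβ.1

/-- A family on all structures definable without parameters is given by one formula, with the same
meaning in `V` and in the ultrapower, so Łoś's theorem applies to it. -/
theorem transfer {n : ℕ} (P : ∀ i : (Σ' M : Type u, M → M → Prop), (Fin n → i.1) → Prop)
    [hP : IsDef (fun i : (Σ' M : Type u, M → M → Prop) => i.2) ∅ P] (f : Fin n → V) :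
    P ⟨ultrapower E κ U, restrictMem E (ultrapower E κ U)⟩ (fun j => toUltrapower E κ U (f j)) ↔
      AE E U (fun β => P ⟨V, E⟩ (fun j => app E (f j) β)) := by
  obtain ⟨m, φ, c, hc, h⟩ := hP.out
  have hm : ∀ k : Fin m, False := fun k => hc k
  have := hU.sat_ultrapower φ (Sum.elim f (fun k => (hm k).elim))
  have h1 : (fun k => toUltrapower E κ U (Sum.elim f (fun k => (hm k).elim) k)) =
      Sum.elim (fun j => toUltrapower E κ U (f j))
        (fun k => c k ⟨ultrapower E κ U, restrictMem E (ultrapower E κ U)⟩) := by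
    funext k
    rcases k with k | k
    · rfl
    · exact (hm k).elim
  have h2 : ∀ β, (fun k => app E (Sum.elim f (fun k => (hm k).elim) k) β) =
      Sum.elim (fun j => app E (f j) β) (fun k => c k ⟨V, E⟩) := by
    intro β
    funext k
    rcases k with k | k
    · rfl
    · exact (hm k).elim
  rw [h1] at this
  simp only [h2] at this
  simp only [h]
  exact this

end IsMeasure

end Los

section InnerModel

variable {V : Type u} {E : V → V → Prop} [hE : SetModel E] {κ U : V}

theorem isDef_sat_cons {ι : Type w} {M : ι → Type u} {E : ∀ i, M i → M i → Prop}
    {A : Set (∀ i, M i)} {n m : ℕ} (φ : setLang.Formula (Fin (n + 1)))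
    {a : ∀ i, (Fin m → M i) → M i} {p : ∀ i, (Fin m → M i) → Fin n → M i} [ha : IsDefFun E A a]
    (hp : ∀ j, IsDefFun E A (fun i v => p i v j)) :
    IsDef E A (fun i v => Sat (E i) φ (Fin.cons (a i v) (p i v))) := by
  refine (IsDef.sat (E := E) (A := A) φ (Fin.cons (α := fun _ => ∀ i, (Fin m → M i) → M i) a
    (fun j i v => p i v j)) (Fin.cases ha hp)).congr fun i v => iff_of_eq (congr_arg _ ?_)
  funext j
  refine Fin.cases ?_ (fun j => ?_) j <;> simp

theorem isDef_sat_cons_cons {ι : Type w} {M : ι → Type u} {E : ∀ i, M i → M i → Prop}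
    {A : Set (∀ i, M i)} {n m : ℕ} (φ : setLang.Formula (Fin (n + 2)))
    {a b : ∀ i, (Fin m → M i) → M i} {p : ∀ i, (Fin m → M i) → Fin n → M i} [ha : IsDefFun E A a]
    [hb : IsDefFun E A b] (hp : ∀ j, IsDefFun E A (fun i v => p i v j)) :
    IsDef E A (fun i v => Sat (E i) φ (Fin.cons (a i v) (Fin.cons (b i v) (p i v)))) :=
  isDef_sat_cons φ (Fin.cases hb hp)

namespace IsMeasure

variable (hU : IsMeasure E κ U)

include hU

/-- Parameters in the ultrapower are represented by functions `f j`. The instance of a schema with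
parameters `f j (β)` holds in `V` for every index `β`, and Łoś's theorem transfers it. -/
theorem modelsZFC_ultrapower : ModelsZFC (restrictMem E (ultrapower E κ U)) := by
  have hsurj : ∀ {n : ℕ} (p : Fin n → ultrapower E κ U), ∃ f : Fin n → V,
      p = fun j => toUltrapower E κ U (f j) := fun p =>
    ⟨fun j => (p j).2.choose, funext fun j => Subtype.ext (p j).2.choose_spec.symm⟩
  refine ⟨?_, fun n φ p => ?_, fun n φ p => ?_⟩
  · exact (hU.transfer (n := 0) (fun i _ => BasicAxioms i.2) Fin.elim0).2
      (hU.ae_of_forall fun _ _ => hE.toBasicAxioms)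
  · obtain ⟨f, rfl⟩ := hsurj p
    have hdef : IsDef (fun i : (Σ' M : Type u, M → M → Prop) => i.2) ∅ (n := n) (fun i p =>
        ∀ a, ∃ b, ∀ x, i.2 x b ↔ i.2 x a ∧ Sat i.2 φ (Fin.cons x p)) := by
      have := isDef_sat_cons (E := fun i : (Σ' M : Type u, M → M → Prop) => i.2) (A := ∅)
        (m := n + 3) φ (a := fun i w => w 0) (p := fun i w => Fin.tail (Fin.tail (Fin.tail w)))
        (fun j => inferInstance)
      infer_instance
    refine (hU.transfer (fun i p => ∀ a, ∃ b, ∀ x, i.2 x b ↔ i.2 x a ∧ Sat i.2 φ (Fin.cons x p)) f).2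
      (hU.ae_of_forall fun β _ a => ?_)
    have := isDef_sat_cons (E := fun _ : Unit => E) (A := Set.univ)
      (m := 1) φ (a := fun i w => w 0) (p := fun _ _ j => app E (f j) β) (fun j => inferInstance)
    exact hE.separation (fun x => Sat E φ (Fin.cons x fun j => app E (f j) β)) a
  · obtain ⟨f, rfl⟩ := hsurj p
    have hdef : IsDef (fun i : (Σ' M : Type u, M → M → Prop) => i.2) ∅ (n := n) (fun i p =>
        ∀ a, (∀ x, i.2 x a → ∃! y, Sat i.2 φ (Fin.cons x (Fin.cons y p))) →
          ∃ b, ∀ y, i.2 y b ↔ ∃ x, i.2 x a ∧ Sat i.2 φ (Fin.cons x (Fin.cons y p))) := by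
      have := isDef_sat_cons_cons (E := fun i : (Σ' M : Type u, M → M → Prop) => i.2) (A := ∅)
        (m := n + 3) φ (a := fun i w => Fin.tail w 0) (b := fun i w => w 0)
        (p := fun i w => Fin.tail (Fin.tail (Fin.tail w))) (fun j => inferInstance)
      have := isDef_sat_cons_cons (E := fun i : (Σ' M : Type u, M → M → Prop) => i.2) (A := ∅)
        (m := n + 4) φ (a := fun i w => w 0) (b := fun i w => Fin.tail w 0)
        (p := fun i w => Fin.tail (Fin.tail (Fin.tail (Fin.tail w)))) (fun j => inferInstance)
      infer_instance
    refine (hU.transfer (fun i p => ∀ a, (∀ x, i.2 x a → ∃! y, Sat i.2 φ (Fin.cons x (Fin.cons y p))) →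
      ∃ b, ∀ y, i.2 y b ↔ ∃ x, i.2 x a ∧ Sat i.2 φ (Fin.cons x (Fin.cons y p))) f).2
      (hU.ae_of_forall fun β _ a ha => ?_)
    have := isDef_sat_cons_cons (E := fun _ : Unit => E) (A := Set.univ)
      (m := 2) φ (a := fun i w => w 0) (b := fun i w => w 1) (p := fun _ _ j => app E (f j) β)
      (fun j => inferInstance)
    exact hE.replacement (fun x y => Sat E φ (Fin.cons x (Fin.cons y fun j => app E (f j) β))) a
      fun x hx y z hy hz => (ha x hx).unique hy hz

theorem transitive_ultrapower (x : V) (hx : x ∈ ultrapower E κ U) (y : V) (hy : E y x) :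
    y ∈ ultrapower E κ U := by
  obtain ⟨f, rfl⟩ := hx
  obtain ⟨h, -, rfl⟩ := hU.mem_collapse.1 hy
  exact ⟨h, rfl⟩

theorem ultraEmbedding_mem_iff {a b : V} :
    E (ultraEmbedding E κ U a) (ultraEmbedding E κ U b) ↔ E a b := by
  unfold ultraEmbedding
  rw [hU.collapse_mem_iff, ← hU.ae_const (P := E a b)]
  constructor <;> refine fun h => (hU.ae_and h (hU.ae_of_forall fun _ h => h)).mono fun β hβ => ?_
  · have h := hβ.1
    rwa [app_constFun hβ.2, app_constFun hβ.2] at h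
  · rw [app_constFun hβ.2, app_constFun hβ.2]
    exact hβ.1

/-- Łoś's theorem makes `j(α)` an ordinal of the ultrapower. As the ultrapower is transitive, being
an ordinal is absolute. -/
theorem isOrd_ultraEmbedding {α : V} (hα : IsOrd E α) : IsOrd E (ultraEmbedding E κ U α) := by
  have h := (hU.transfer (n := 1) (fun i v => IsOrd i.2 (v 0)) (fun _ => constFun E κ α)).2
    (hU.ae_of_forall fun β hβ => by simp only [app_constFun hβ]; exact hα)
  have htr := hU.transitive_ultrapower
  have hmem : ultraEmbedding E κ U α ∈ ultrapower E κ U := ⟨_, rfl⟩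
  refine ⟨fun y hy z hz => ?_, fun x hx y hy z hz => ?_⟩
  · exact h.1 ⟨y, htr _ hmem y hy⟩ hy ⟨z, htr _ (htr _ hmem y hy) z hz⟩ hz
  · exact h.2 ⟨x, htr _ hmem x hx⟩ hx ⟨y, htr _ (htr _ hmem x hx) y hy⟩ hy
      ⟨z, htr _ (htr _ (htr _ hmem x hx) y hy) z hz⟩ hz

theorem isClsFun_ultraEmbedding : IsClsFun E (fun a => ultraEmbedding E κ U a) := by
  have hcol := fun {n} => hU.isClsFun_collapse.comp (n := n)
  exact hcol (fun _ v => constFun E κ (v 0))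

theorem isOrd_mem_ultrapower {α : V} (hα : IsOrd E α) : α ∈ ultrapower E κ U := by
  have hj := fun {n} => hU.isClsFun_ultraEmbedding.comp (n := n)
  -- If `j(α) ∈ α`, applying `j` gives `j(j(α)) ∈ j(α)`, so `j(α)` is a smaller counterexample.
  have key : ∀ α, IsOrd E α → ¬ E (ultraEmbedding E κ U α) α := by
    refine SetModel.induction E (fun α => IsOrd E α → ¬ E (ultraEmbedding E κ U α) α)
      fun α ih hα h => ?_
    exact ih _ h (hα.mem h) (hU.ultraEmbedding_mem_iff.2 h)
  have hmem : ultraEmbedding E κ U α ∈ ultrapower E κ U := ⟨_, rfl⟩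
  rcases hα.trichotomy (hU.isOrd_ultraEmbedding hα) with h | h | h
  · exact hU.transitive_ultrapower _ hmem α h
  · exact h ▸ hmem
  · exact absurd h (key α hα)

theorem isCls_ultrapower : IsCls E (fun x => x ∈ ultrapower E κ U) := by
  have hcol := fun {n} => hU.isClsFun_collapse.comp (n := n)
  have : IsCls E (fun x => ∃ f, collapse E κ U f = x) := inferInstance
  exact this

end IsMeasure

end InnerModel

/-! ### The embedding fixes `V_κ` pointwise and moves `κ` -/

section FixedPoints

variable {V : Type u} (E : V → V → Prop) [hE : SetModel E] {κ U : V}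

/-- Each function with values in `x` is constant on a set in `U`. -/
def IsConcentrated (U x : V) : Prop :=
  ∀ f, AE E U (fun α => E (app E f α) x) → ∃ z, E z x ∧ AE E U (fun α => app E f α = z)

instance IsDef.isConcentrated {ι : Type w} {M : ι → Type u} {E : ∀ i, M i → M i → Prop}
    {A : Set (∀ i, M i)} {n : ℕ} [∀ i, SetModel (E i)] {a b : ∀ i, (Fin n → M i) → M i}
    [IsDefFun E A a] [IsDefFun E A b] :
    IsDef E A (fun i v => IsConcentrated (E i) (a i v) (b i v)) := by
  unfold IsConcentrated
  infer_instance

variable {E}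

theorem mem_level_of_mem {κ a b : V} (hκ : IsOrd E κ) (ha : E a (level E κ)) (hb : E b a) :
    E b (level E κ) := by
  obtain ⟨γ, hγ, h⟩ := (mem_level hκ).1 ha
  exact level_mono hκ hγ b (h b hb)

theorem isSub_level_self {α : V} (hα : IsOrd E α) : IsSub E α (level E α) := by
  have key : ∀ α, IsOrd E α → ∀ β, E β α → MemVLevel E α β := by
    refine SetModel.induction E (fun α => IsOrd E α → ∀ β, E β α → MemVLevel E α β)
      fun α ih hα β hβ => ?_
    refine (mem_level_iff hα).1 ((mem_level hα).2 ⟨β, hβ, fun γ hγ => ?_⟩)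
    exact (mem_level_iff (hα.mem hβ)).2 (ih β hβ (hα.mem hβ) γ hγ)
  exact fun β hβ => (mem_level_iff hα).2 (key α hα β hβ)

namespace IsMeasure

variable (hU : IsMeasure E κ U)

include hU

theorem isConcentrated_of_isSub {x y : V} (hy : IsConcentrated E U y) (h : IsSub E x y) :
    IsConcentrated E U x := by
  intro f hf
  obtain ⟨z, -, hz⟩ := hy f (hf.mono fun α hα => h _ hα)
  obtain ⟨α, -, hα, rfl⟩ := hU.ae_exists (hU.ae_and hf hz)
  exact ⟨_, hα, hz⟩

/-- The constant value is `A`, the set of `z ∈ x` that lie in almost every `f(α)`. Were `f(α) ≠ A`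
almost everywhere, a choice from the symmetric difference would have an almost constant value `z`,
which contradicts the definition of `A` whether or not `z ∈ A`. -/
theorem isConcentrated_pset {x y : V} (hx : IsConcentrated E U x) (hy : IsSub E y (pset E x))
    (hxy : IsSub E (pset E x) y) : IsConcentrated E U y := by
  intro f hf
  have hf : AE E U (fun α => IsSub E (app E f α) x) := hf.mono fun α hα => mem_pset.1 (hy _ hα)
  let A := sep E x (fun z => AE E U (fun α => E z (app E f α)))
  have hAx : IsSub E A x := fun z hz => (mem_sep.1 hz).1
  refine ⟨A, hxy A (mem_pset.2 hAx), ?_⟩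
  by_contra hne
  obtain ⟨g, hg⟩ := exists_choice (E := E) (fun α z => ¬ (E z (app E f α) ↔ E z A)) κ
  have hg : AE E U (fun α => ¬ (E (app E g α) (app E f α) ↔ E (app E g α) A)) :=
    (hU.ae_and (hU.not_ae.1 hne) (hU.ae_of_forall fun _ h => h)).mono fun α hα => hg α hα.2 (by
      by_contra hne
      push Not at hne
      exact hα.1 (hE.extensional hne))
  obtain ⟨z, hz, hgz⟩ := hx g ((hU.ae_and hf hg).mono fun α hα => by
    by_cases h : E (app E g α) (app E f α)
    · exact hα.1 _ h
    · exact hAx _ (by tauto))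
  have hzA : AE E U (fun α => ¬ (E z (app E f α) ↔ E z A)) := (hU.ae_and hg hgz).mono fun α hα => by
    have h := hα.1
    rwa [hα.2] at h
  by_cases h : AE E U (fun α => E z (app E f α))
  · obtain ⟨α, -, h1, h2⟩ := hU.ae_exists (hU.ae_and hzA h)
    exact h1 ⟨fun _ => mem_sep.2 ⟨hz, h⟩, fun _ => h2⟩
  · obtain ⟨α, -, h1, h2⟩ := hU.ae_exists (hU.ae_and hzA (hU.not_ae.1 h))
    exact h1 ⟨fun h' => absurd h' h2, fun h' => absurd (mem_sep.1 h').2 h⟩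

/-- `V_β` is the union of fewer than `κ` power sets of earlier levels, so almost all values fall in
one of them and the power set case applies. Inaccessibility of `κ` is not needed. -/
theorem isConcentrated_level {β : V} (hβ : E β κ) : IsConcentrated E U (level E β) := by
  have key : ∀ β, E β κ → ∀ v, (∀ x, E x v ↔ MemVLevel E β x) → IsConcentrated E U v := by
    refine SetModel.induction E
      (fun β => E β κ → ∀ v, (∀ x, E x v ↔ MemVLevel E β x) → IsConcentrated E U v)
      fun β ih hβ v hv f hf => ?_
    have hβo := hU.isOrd.mem hβ
    have hv : ∀ x, E x v ↔ ∃ γ, E γ β ∧ IsSub E x (level E γ) := fun x =>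
      (hv x).trans ((mem_level_iff hβo).symm.trans (mem_level hβo))
    obtain ⟨γ, hγ, hfγ⟩ := hU.exists_lt_ae hβ (fun γ α => ∀ x, E x (app E f α) → MemVLevel E γ x)
      (hf.mono fun α hα => by
        obtain ⟨γ, hγ, h⟩ := (hv _).1 hα
        exact ⟨γ, hγ, fun x hx => (mem_level_iff (hβo.mem hγ)).1 (h x hx)⟩)
    have hlev := ih γ hγ (hU.isOrd.trans hβ hγ) (level E γ) fun x => mem_level_iff (hβo.mem hγ)
    obtain ⟨z, hz, hfz⟩ := hU.isConcentrated_pset hlev (y := pset E (level E γ)) (fun _ h => h)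
      (fun _ h => h) f
      (hfγ.mono fun α hα => mem_pset.2 fun x hx => (mem_level_iff (hβo.mem hγ)).2 (hα x hx))
    exact ⟨z, (hv z).2 ⟨γ, hγ, mem_pset.1 hz⟩, hfz⟩
  exact key β hβ _ fun x => mem_level_iff (hU.isOrd.mem hβ)

/-- An element of `j(a)` is represented by a function into `a`, which is almost constant with some
value `b ∈ a`, so the element is `j(b)`. By `∈`-induction this is `b`. -/
theorem ultraEmbedding_eq_self {a : V} (ha : MemVLevel E κ a) : ultraEmbedding E κ U a = a := by
  have hj := fun {n} => hU.isClsFun_ultraEmbedding.comp (n := n)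
  refine SetModel.induction E (fun a => MemVLevel E κ a → ultraEmbedding E κ U a = a)
    (fun a ih ha => ?_) a ha
  have ha := (mem_level_iff hU.isOrd).2 ha
  have ih : ∀ b, E b a → ultraEmbedding E κ U b = b := fun b hb =>
    ih b hb ((mem_level_iff hU.isOrd).1 (mem_level_of_mem hU.isOrd ha hb))
  obtain ⟨γ, hγ, hsub⟩ := (mem_level hU.isOrd).1 ha
  have hconc := hU.isConcentrated_of_isSub (hU.isConcentrated_level hγ) hsub
  refine hE.extensional fun z => ⟨fun hz => ?_, fun hz => ?_⟩
  · obtain ⟨h, hlt, rfl⟩ := hU.mem_collapse.1 hz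
    obtain ⟨b, hb, hhb⟩ := hconc h ((hU.ae_and hlt (hU.ae_of_forall fun _ h => h)).mono fun α hα => by
      have h := hα.1
      rwa [app_constFun hα.2] at h)
    have : EqU E U h (constFun E κ b) :=
      (hU.ae_and hhb (hU.ae_of_forall fun _ h => h)).mono fun α hα => by
        rw [app_constFun hα.2, hα.1]
    rw [hU.collapse_congr this]
    have := ih b hb
    unfold ultraEmbedding at this
    rwa [this]
  · have := hU.ultraEmbedding_mem_iff.2 hz
    rwa [ih z hz] at this

/-- The identity `d` on `κ` represents an ordinal below `j(κ)`. It lies above each `β = j(β)` with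
`β ∈ κ`, since otherwise `d` would be almost constant. Hence `κ ≤ [d] < j(κ)`. -/
theorem mem_ultraEmbedding_self : E κ (ultraEmbedding E κ U κ) := by
  let d := graphOn E κ (fun x => x)
  have hd : ∀ α, E α κ → app E d α = α := fun α hα => app_graphOn (F := fun x => x) hα
  have hdκ : E (collapse E κ U d) (ultraEmbedding E κ U κ) :=
    hU.collapse_mem_iff.2 (hU.ae_of_forall fun α hα => by rwa [app_constFun hα, hd α hα])
  have hsub : ∀ β, E β κ → E β (collapse E κ U d) := by
    intro β hβ
    have hβo := hU.isOrd.mem hβ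
    have hconc := hU.isConcentrated_of_isSub (hU.isConcentrated_level hβ) (isSub_level_self hβo)
    have hnot : ¬ AE E U (fun α => E (app E d α) β) := by
      intro h
      obtain ⟨z, -, hz⟩ := hconc d h
      obtain ⟨α, hα, h1, h2⟩ := hU.ae_exists (hU.ae_and hz (hU.ae_ne z))
      exact h2 ((hd α hα).symm.trans h1)
    have hlt : LtU E U (constFun E κ β) d :=
      (hU.ae_and (hU.not_ae.1 hnot) (hU.ae_and (hU.ae_ne β) (hU.ae_of_forall fun _ h => h))).mono
        fun α ⟨h1, h2, hα⟩ => by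
          rw [hd α hα] at h1
          rw [hd α hα, app_constFun hα]
          rcases (hU.isOrd.mem hα).trichotomy hβo with h | h | h
          · exact absurd h h1
          · exact absurd h h2
          · exact h
    have := hU.collapse_mem_iff.2 hlt
    have hfix := hU.ultraEmbedding_eq_self
      ((mem_level_iff hU.isOrd).1 (isSub_level_self hU.isOrd β hβ))
    unfold ultraEmbedding at hfix
    rwa [hfix] at this
  have hjκ := hU.isOrd_ultraEmbedding hU.isOrd
  rcases (hjκ.mem hdκ).trichotomy hU.isOrd with h | h | h
  · exact absurd (hsub _ h) (not_mem_self _)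
  · rwa [h] at hdκ
  · exact hjκ.trans hdκ h

end IsMeasure

end FixedPoints

/-! ## The ultrapower is not the universe -/

section Proper

variable {V : Type u} {E : V → V → Prop}

theorem sat_restrictMem_of_eq_univ {W : Set V} (hW : W = Set.univ) {α : Type}
    (φ : setLang.Formula α) (v : α → W) :
    Sat (restrictMem E W) φ v ↔ Sat E φ (fun j => (v j : V)) := by
  let _ := memStructure (restrictMem E W)
  let _ := memStructure E
  let e : W ≃[setLang] V :=
    { toEquiv := (Equiv.setCongr hW).trans (Equiv.Set.univ V)
      map_fun' := fun f => Empty.elim f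
      map_rel' := fun r v => by cases r; rfl }
  exact (StrongHomClass.realize_formula e φ).symm

variable [hE : SetModel E]

theorem IsMeasure.ultrapower_ne_univ {κ U : V} (hU : IsMeasure E κ U) :
    ultrapower E κ U ≠ Set.univ := by
  intro huniv
  -- This states internally that some measure on `κ` has collapsed ultrapower `V`. It is first-order
  -- without parameters, so "least `κ` with `Q`" is preserved by `j`.
  let Q : V → Prop := fun κ => ∃ U, IsMeasure E κ U ∧ ∀ z, ∃ f, CollapsesTo E κ U f z
  have hQ : ∀ A : Set (Unit → V), IsDef (ι := Unit) (M := fun _ => V) (fun _ => E) A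
      (fun _ (v : Fin 1 → V) => Q (v 0)) := fun A => by
    dsimp only [Q]
    infer_instance
  have hleast : IsDef (ι := Unit) (M := fun _ => V) (fun _ => E) ∅
      (fun _ (v : Fin 1 → V) => Q (v 0) ∧ ∀ μ, E μ (v 0) → ¬ Q μ) := by
    dsimp only [Q]
    infer_instance
  have hcls : IsCls E Q := hQ _
  obtain ⟨κ, ⟨U, hU, hall⟩, hmin⟩ := hE.class_foundation Q
    ⟨κ, U, hU, fun z => by
      obtain ⟨f, rfl⟩ := huniv.symm ▸ Set.mem_univ z
      exact ⟨f, hU.eq_collapse_iff.1 rfl⟩⟩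
  have huniv : ultrapower E κ U = Set.univ := Set.eq_univ_of_forall fun z => by
    obtain ⟨f, hf⟩ := hall z
    exact ⟨f, (hU.eq_collapse_iff.2 hf).symm⟩
  obtain ⟨m, φ, c, hc, hφ⟩ := hleast.out
  have hm : ∀ k : Fin m, False := fun k => hc k
  have h := (hU.sat_ultrapower_const φ (Sum.elim (fun _ => κ) (fun k => c k ()))).2
    ((hφ () (fun _ => κ)).1 ⟨⟨U, hU, hall⟩, hmin⟩)
  rw [sat_restrictMem_of_eq_univ huniv] at h
  have h' := (hφ () (fun _ => ultraEmbedding E κ U κ)).2 (by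
    convert h using 2 with j
    rcases j with j | j
    · rfl
    · exact (hm j).elim)
  exact h'.2 κ hU.mem_ultraEmbedding_self ⟨U, hU, hall⟩

end Proper

/-! ## Gödel-Bernays models -/

section GBC

variable {V : Type u} {E : V → V → Prop} {𝒞 : Set (Set V)}

/-- The inclusion of the language of set theory in the language with class predicates. -/
def toClassLang (𝒞 : Set (Set V)) : setLang →ᴸ classLang 𝒞 where
  onFunction := fun _ f => Empty.elim f
  onRelation := fun _ r => match r with
    | MemRel.mem => ClassRel.mem

theorem ModelsGBC.setOf_mem (hV : ModelsGBC E 𝒞) (P : V → Prop) [hP : IsCls E P] :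
    {x | P x} ∈ 𝒞 := by
  obtain ⟨m, φ, c, -, h⟩ := hP.out
  have := hV.comprehension m ((toClassLang 𝒞).onFormula (φ.relabel
    (Sum.elim (fun _ => 0) (fun k => k.succ) : Fin 1 ⊕ Fin m → Fin (m + 1)))) (fun k => c k ())
  convert this using 2
  ext x
  rw [h () (fun _ => x)]
  let _ := memStructure E
  let _ := classStructure E 𝒞
  have hexp : (toClassLang 𝒞).IsExpansionOn V :=
    { map_onFunction := fun f => Empty.elim f
      map_onRelation := fun r => by cases r; intro _; rfl }
  unfold ClassSat
  rw [LHom.realize_onFormula, Formula.realize_relabel]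
  refine iff_of_eq (congr_arg _ ?_)
  funext k
  rcases k with k | k <;> rfl

/-- Pairs are handled from the basic axioms alone, because `SetModel` for a GBC model is obtained by
way of this fact. -/
theorem BasicAxioms.isPair_inj (hE : BasicAxioms E) {p x y z w : V} (h : IsPair E p x y)
    (h' : IsPair E p z w) : x = z ∧ y = w := by
  have huniq : ∀ {s t x y}, IsUPair E s x y → IsUPair E t x y → s = t := fun hs ht =>
    hE.ext _ _ fun z => (hs z).trans (ht z).symm
  have hinj : ∀ {s x y z w}, IsUPair E s x y → IsUPair E s z w →
      (x = z ∧ y = w) ∨ (x = w ∧ y = z) := by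
    intro s x y z w h h'
    have h1 := (h' x).1 ((h x).2 (Or.inl rfl))
    have h2 := (h' y).1 ((h y).2 (Or.inr rfl))
    have h3 := (h z).1 ((h' z).2 (Or.inl rfl))
    have h4 := (h w).1 ((h' w).2 (Or.inr rfl))
    grind
  obtain ⟨s, hs⟩ := hE.pairing x x
  obtain ⟨t, ht⟩ := hE.pairing x y
  obtain ⟨s', hs'⟩ := hE.pairing z z
  obtain ⟨t', ht'⟩ := hE.pairing z w
  have h1 := (h' s).1 ((h s).2 (Or.inl hs))
  have h2 := (h' t).1 ((h t).2 (Or.inr ht))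
  have h3 := (h s').1 ((h' s').2 (Or.inl hs'))
  have h4 := (h t').1 ((h' t').2 (Or.inr ht'))
  grind

theorem BasicAxioms.exists_pair (hE : BasicAxioms E) (x y : V) : ∃ p, IsPair E p x y := by
  obtain ⟨s, hs⟩ := hE.pairing x x
  obtain ⟨t, ht⟩ := hE.pairing x y
  obtain ⟨p, hp⟩ := hE.pairing s t
  refine ⟨p, fun z => (hp z).trans (or_congr ⟨fun h => h ▸ hs, fun h => ?_⟩
    ⟨fun h => h ▸ ht, fun h => ?_⟩)⟩
  · exact hE.ext _ _ fun w => (h w).trans (hs w).symm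
  · exact hE.ext _ _ fun w => (h w).trans (ht w).symm

theorem ModelsGBC.image_relation (hV : ModelsGBC E 𝒞) (R : V → V → Prop) [hR : IsClsRel E R]
    (hfun : ∀ x y z, R x y → R x z → y = z) (a : V) : ∃ b, ∀ y, E y b ↔ ∃ x, E x a ∧ R x y := by
  have hR' := fun {n} => hR.comp (n := n)
  have hmem : ∀ p x y, IsPair E p x y → (p ∈ {p | ∃ x y, IsPair E p x y ∧ R x y} ↔ R x y) := by
    intro p x y hp
    constructor
    · rintro ⟨x', y', hp', h⟩
      obtain ⟨rfl, rfl⟩ := hV.toBasicAxioms.isPair_inj hp hp'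
      exact h
    · exact fun h => ⟨x, y, hp, h⟩
  obtain ⟨b, hb⟩ := hV.class_replacement _ (hV.setOf_mem fun p => ∃ x y, IsPair E p x y ∧ R x y)
    (fun x y z p q hp hpF hq hqF => hfun x y z ((hmem p x y hp).1 hpF) ((hmem q x z hq).1 hqF)) a
  refine ⟨b, fun y => (hb y).trans (exists_congr fun x => and_congr_right fun _ => ?_)⟩
  constructor
  · rintro ⟨p, hpF, hp⟩
    exact (hmem p x y hp).1 hpF
  · intro h
    obtain ⟨p, hp⟩ := hV.toBasicAxioms.exists_pair x y
    exact ⟨p, (hmem p x y hp).2 h, hp⟩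

theorem ModelsGBC.setModel (hV : ModelsGBC E 𝒞) : SetModel E where
  toBasicAxioms := hV.toBasicAxioms
  separation P hP a := by
    have hP' := fun {n} => hP.comp (n := n)
    -- Separation is replacement for the identity restricted to `P`.
    obtain ⟨b, hb⟩ := hV.image_relation (fun x y => x = y ∧ P x)
      (fun x y z h h' => h.1.symm.trans h'.1) a
    refine ⟨b, fun x => (hb x).trans ⟨?_, fun h => ⟨x, h.1, rfl, h.2⟩⟩⟩
    rintro ⟨_, h, rfl, hx⟩
    exact ⟨h, hx⟩
  replacement R hR a h := by
    -- `R` is single-valued only on `a`, while class replacement requires this everywhere.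
    obtain ⟨b, hb⟩ := hV.image_relation (fun x y => E x a ∧ R x y)
      (fun x y z hy hz => h x hy.1 y z hy.2 hz.2) a
    refine ⟨b, fun y => (hb y).trans (exists_congr fun x => ?_)⟩
    tauto
  class_foundation P hP h := by
    obtain ⟨x, hx, hmin⟩ := hV.class_foundation _ (hV.setOf_mem P) h
    exact ⟨x, hx, hmin⟩

theorem ModelsGBC.isInnerModel_ultrapower (hV : ModelsGBC E 𝒞) [SetModel E] {κ U : V}
    (hU : IsMeasure E κ U) : IsInnerModel E 𝒞 (ultrapower E κ U) where
  isClass :=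
    have := hU.isCls_ultrapower
    hV.setOf_mem (fun x => x ∈ ultrapower E κ U)
  transitive := hU.transitive_ultrapower
  ordinals _ := hU.isOrd_mem_ultrapower
  models := hU.modelsZFC_ultrapower

theorem ModelsGBC.reflection_of_isMeasurableCard (hV : ModelsGBC E 𝒞) {κ : V}
    (hκ : IsMeasurableCard E κ) : InnerModelReflectionFor E 𝒞 {a | MemVLevel E κ a} := by
  have := hV.setModel
  obtain ⟨U, hU⟩ := isMeasurableCard_iff.1 hκ
  intro n φ a ha hsat
  have hfix : ∀ j, ultraEmbedding E κ U (a j) = a j := fun j => hU.ultraEmbedding_eq_self (ha j)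
  refine ⟨ultrapower E κ U, hV.isInnerModel_ultrapower hU, hU.ultrapower_ne_univ,
    fun j => ⟨constFun E κ (a j), hfix j⟩, ?_⟩
  have h := (hU.sat_ultrapower_const φ a).2 hsat
  convert h using 2 with j
  exact Subtype.ext (hfix j).symm

/-- If no measurable cardinal exceeded `θ`, all of them would lie in `θ ∪ {θ}` and form a set by
separation. -/
theorem exists_isMeasurableCard_above [hE : SetModel E]
    (h : ¬ ∃ s, ∀ κ, E κ s ↔ IsMeasurableCard E κ) {θ : V} (hθ : IsOrd E θ) :
    ∃ κ, IsMeasurableCard E κ ∧ E θ κ := by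
  by_contra hne
  push Not at hne
  obtain ⟨s, hs⟩ := hE.separation (fun κ => IsMeasurableCard E κ) (insertSet E θ θ)
  refine h ⟨s, fun κ => (hs κ).trans (and_iff_right_of_imp fun hκ => mem_insertSet.2 ?_)⟩
  rcases hκ.1.1.1.trichotomy hθ with h | h | h
  · exact Or.inl h
  · exact Or.inr h
  · exact absurd h (hne κ hκ)

theorem exists_level_of_finite [hE : SetModel E] {n : ℕ} (a : Fin n → V) :
    ∃ θ, IsOrd E θ ∧ ∀ j, E (a j) (level E θ) := by
  induction n with
  | zero =>
    obtain ⟨x⟩ := SetModel.nonempty E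
    obtain ⟨θ, hθ, -⟩ := exists_mem_level E x
    exact ⟨θ, hθ, fun j => j.elim0⟩
  | succ n ih =>
    obtain ⟨θ, hθ, h⟩ := ih (fun j => a j.succ)
    obtain ⟨η, hη, h0⟩ := exists_mem_level E (a 0)
    rcases hθ.trichotomy hη with hlt | rfl | hlt
    · exact ⟨η, hη, Fin.cases h0 fun j => level_mono hη hlt _ (h j)⟩
    · exact ⟨θ, hθ, Fin.cases h0 h⟩
    · exact ⟨θ, hθ, Fin.cases (level_mono hθ hlt _ h0) h⟩

end GBC

end InnerModelReflect

open InnerModelReflect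
theorem theorem3p1 {V : Type*} (E : V → V → Prop) (𝒞 : Set (Set V)) (hV : ModelsGBC E 𝒞) :
    -- if there is a measurable cardinal, then the lightface principle holds
    ((∃ κ, IsMeasurableCard E κ) → LightfaceInnerModelReflection E 𝒞) ∧
    -- if `κ` is measurable, then the principle holds for parameters in `V_κ`
    (∀ κ, IsMeasurableCard E κ → InnerModelReflectionFor E 𝒞 {a | MemVLevel E κ a}) ∧
    -- if the measurable cardinals do not form a set, then the full principle holds
    ((¬ ∃ s, ∀ κ, E κ s ↔ IsMeasurableCard E κ) → InnerModelReflection E 𝒞) := by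
  have := hV.setModel
  refine ⟨?_, fun κ hκ => hV.reflection_of_isMeasurableCard hκ, ?_⟩
  · rintro ⟨κ, hκ⟩ σ hσ
    -- A sentence is read as a formula with an empty tuple of parameters.
    obtain ⟨W, hW, hne, ha, h⟩ := hV.reflection_of_isMeasurableCard hκ 0
      (σ.relabel (Empty.elim : Empty → Fin 0)) Fin.elim0 (fun j => j.elim0)
      ((sat_relabel E σ _ _).2 (by rwa [Subsingleton.elim (_ ∘ _) Empty.elim]))
    refine ⟨W, hW, hne, ?_⟩
    rw [sat_relabel] at h
    rwa [Subsingleton.elim Empty.elim (_ ∘ _)]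
  · intro h n φ a _ hφ
    obtain ⟨θ, hθ, ha⟩ := exists_level_of_finite (E := E) a
    obtain ⟨κ, hκ, hlt⟩ := exists_isMeasurableCard_above h hθ
    exact hV.reflection_of_isMeasurableCard hκ n φ a
      (fun j => (mem_level_iff hκ.1.1.1).1 (level_mono hκ.1.1.1 hlt _ (ha j))) hφ
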